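/- Let $b$ be an integer and let $D\subset\{0,1,\ldots,b-1\}$ be a set of digits with $0\in D$ and $|D|\ge 2$. Let $$\mathcal C=\mathcal C_{b,D}=\Bigl\{\sum_{j=0}^{k} d_j b^j : k\ge 0,\ d_j\in D\Bigr\}=\{k_1<k_2<\cdots\}$$ be the associated integer Cantor set, and let $s_b(k)$ denote the sum of the base-$b$ digits of $k$. Write $e(x)=e^{2\pi i x}$. Call a polynomial $p\in\mathbb R[x,y]$ *irrational* if some monomial of $p$ other than the constant one has an irrational coefficient. Then the sequence $(k_n,s_b(k_n))_{n\ge 1}$ in $\mathbb Z^2$ is polynomial uniformly distributed, uniformly (PUDU). That is: 1. For every irrational $p\in\mathbb R[x,y]$, the sequence $p(k_n,s_b(k_n))$ is uniformly distributed mod $1$, and for every nonzero integer $m$, $$\lim_{N-M\to\infty}\frac1{N-M}\sum_{M<n\le N} e\bigl(m\,p(k_n,s_b(k_n))\bigr)=0,$$ where $0\le M<N$ and the limit is uniform over all windows $(M,N]$ of length $N-M\to\infty$. 2. For every pair $p=(p_1,p_2)$ of polynomials in $\mathbb R[x,y]$ such that $m\cdot p=m_1p_1+m_2p_2$ is irrational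 for each $m\in\mathbb Z^2\setminus\{(0,0)\}$, the sequence $p(k_n,s_b(k_n))\in\mathbb R^2$ is uniformly distributed mod $1$ in $[0,1]^2$, and for every $m\in\mathbb Z^2\setminus\{(0,0)\}$, $$\lim_{N-M\to\infty}\frac1{N-M}\sum_{M<n\le N} e\bigl(m\cdot p(k_n,s_b(k_n))\bigr)=0.$$ -/

import Mathlib

open Filter Topology

/-- The integer Cantor set with base `b` and digit set `D`: all sums
`d₀ + d₁ b + ⋯ + dₖ bᵏ` with every `dⱼ ∈ D`. -/
def integerCantorSet (b : ℕ) (D : Finset ℕ) : Set ℕ :=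
  {n | ∃ (k : ℕ) (d : ℕ → ℕ), (∀ j ≤ k, d j ∈ D) ∧ n = ∑ j ∈ Finset.range (k + 1), d j * b ^ j}

/-- The increasing enumeration `k₁ < k₂ < ⋯` of the Cantor set, indexed from `1`
(`Nat.nth` counts from `0`; the value at the index `0` is never used). -/
noncomputable def cantorSeq (b : ℕ) (D : Finset ℕ) (n : ℕ) : ℕ :=
  Nat.nth (fun m => m ∈ integerCantorSet b D) (n - 1)

/-- The sum of the base-`b` digits of `k`. -/
def sumOfDigits (b k : ℕ) : ℕ := (Nat.digits b k).sum

/-- A real polynomial in two variables is irrational if some monomial other than the constant one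
has an irrational coefficient. -/
def IsIrrationalPoly (p : MvPolynomial (Fin 2) ℝ) : Prop :=
  ∃ μ : Fin 2 →₀ ℕ, μ ≠ 0 ∧ Irrational (p.coeff μ)

/-- The sequence `y₁, y₂, …` in `ℝᵈ` is uniformly distributed mod `1`: every open box in the unit
cube receives the correct asymptotic proportion of the fractional parts. -/
def IsUniformlyDistributedModOne {d : ℕ} (y : ℕ → Fin d → ℝ) : Prop :=
  ∀ a c : Fin d → ℝ, (∀ i, 0 ≤ a i ∧ a i < c i ∧ c i ≤ 1) →
    Tendsto
      (fun N : ℕ =>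
        ({n : ℕ | n ∈ Finset.Icc 1 N ∧ ∀ i, Int.fract (y n i) ∈ Set.Ioo (a i) (c i)}.ncard : ℝ) / N)
      atTop (𝓝 (∏ i, (c i - a i)))

/-- The Weyl sums of `y₁, y₂, …` vanish uniformly over windows: for every nonzero integer vector
`m`, the average of `e(m · yₙ)` over `M < n ≤ N` tends to `0` as `N - M → ∞`. -/
def WeylSumsVanishUniformly {d : ℕ} (y : ℕ → Fin d → ℝ) : Prop :=
  ∀ m : Fin d → ℤ, m ≠ 0 →
    Tendsto
      (fun w : ℕ × ℕ =>
        (∑ n ∈ Finset.Ioc w.1 w.2,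
          Complex.exp (2 * Real.pi * Complex.I * ((∑ i, (m i : ℝ) * y n i : ℝ) : ℂ))) /
            ((w.2 : ℂ) - (w.1 : ℂ)))
      (comap (fun w : ℕ × ℕ => (w.2 : ℤ) - (w.1 : ℤ)) atTop) (𝓝 0)

/-- The value of a real polynomial in two variables at an integer point. -/
noncomputable def evalAtInt (p : MvPolynomial (Fin 2) ℝ) (x : Fin 2 → ℤ) : ℝ :=
  MvPolynomial.eval (fun i => (x i : ℝ)) p

/-- Polynomial uniform distribution, uniformly (PUDU), of a sequence `x₁, x₂, …` in `ℤ²`.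
The first clause is for real-valued polynomials. The second is for pairs `p = (p₀, p₁)` of
polynomials, where irrationality means that `m · p` is irrational for each nonzero `m ∈ ℤ²`. -/
def IsPUDU (x : ℕ → Fin 2 → ℤ) : Prop :=
  (∀ p : MvPolynomial (Fin 2) ℝ, IsIrrationalPoly p →
    IsUniformlyDistributedModOne (fun n (_ : Fin 1) => evalAtInt p (x n)) ∧
    WeylSumsVanishUniformly (fun n (_ : Fin 1) => evalAtInt p (x n))) ∧
  (∀ p : Fin 2 → MvPolynomial (Fin 2) ℝ,
    (∀ m : Fin 2 → ℤ, m ≠ 0 → IsIrrationalPoly (∑ i, m i • p i)) →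
    IsUniformlyDistributedModOne (fun n i => evalAtInt (p i) (x n)) ∧
    WeylSumsVanishUniformly (fun n i => evalAtInt (p i) (x n)))

/-! ### Weyl's criterion on the torus. -/

section Weyl

open MeasureTheory

/-! Writing `n` in base `D.card` and replacing each digit by the corresponding element of `D`
enumerates the Cantor set in order. Hence the first `D.card ^ n` points `(k, s_b(k))` are sums of
`n` independent digit contributions `d • (b ^ j, 1)`, and each later aligned block of this length is
a translate of the first. The proof is van der Corput differencing adapted to this structure,
followed by Weyl's criterion.

For an additive `φ` on `ℤ × ℤ`, the average of `e(φ)` is a product of digit factors of norm at most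
`1`. If it does not tend to `0`, the factors tend to `1`, and the repelling fixed point `1` of `z ↦
z ^ b` forces `φ` to be rational-valued (`tendsto_norm_cantorAvg_linear`).

In higher degree, splitting low digits from high digits and applying Cauchy–Schwarz replaces `f` by
its differences along `x - x'`, with `x`, `x'` random sums of low digits. The differenced function
keeps an irrational leading part whenever a certain additive `φ` is irrational at `x - x'`; the
linear case, applied to multiples of `φ`, shows that this holds for most pairs. The induction
`exists_norm_cantorAvg_le` gives bounds uniform in lower-degree terms. As translation changes `f`
only by such terms, every block obeys the same bound, whence uniformity over windows
(`windowAveragesVanish_of_fwdDiffs`).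

For a polynomial, take an irrational monomial of maximal total degree. All monomials of larger
degree are rational, so their phase is periodic and a finite Fourier expansion turns it into
rational linear terms, which cannot spoil irrationality. -/

lemma integral_fourier_unitAddCircle {n : ℤ} (hn : n ≠ 0) :
    ∫ t : UnitAddCircle, fourier n t = 0 := by
  have h := fun x : UnitAddCircle => fourier_add_half_inv_index hn one_pos x
  have h2 := integral_add_right_eq_self (μ := (volume : Measure UnitAddCircle))
    (fun t : UnitAddCircle => (fourier n t : ℂ)) (((1 / 2 / n : ℝ) : UnitAddCircle))
  simp only [h, integral_neg] at h2
  linear_combination (-1 / 2 : ℂ) * h2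

instance : IsProbabilityMeasure (volume : Measure UnitAddCircle) :=
  ⟨UnitAddCircle.measure_univ⟩

lemma integral_mFourier {d : ℕ} {m : Fin d → ℤ} (hm : m ≠ 0) :
    ∫ t, UnitAddTorus.mFourier m t ∂(Measure.pi fun _ : Fin d => (volume : Measure UnitAddCircle))
      = 0 := by
  obtain ⟨i, hi⟩ := Function.ne_iff.mp hm
  have := integral_fintype_prod_eq_prod (μ := fun _ : Fin d => (volume : Measure UnitAddCircle))
    (fun i (t : UnitAddCircle) => (fourier (m i) t : ℂ))
  refine this.trans (Finset.prod_eq_zero (Finset.mem_univ i) ?_)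
  exact integral_fourier_unitAddCircle hi

lemma unitAddCircle_coe_eq_coe_iff {x y : ℝ} :
    (x : UnitAddCircle) = y ↔ ∃ k : ℤ, x - y = k := by
  rw [← sub_eq_zero, ← AddCircle.coe_sub, AddCircle.coe_eq_zero_iff]
  simp [eq_comm]

/-- The arc of the circle `ℝ / ℤ` that is the image of the open interval `(a, c)`. -/
def circleArc (a c : ℝ) : Set UnitAddCircle := (fun x : ℝ => (x : UnitAddCircle)) '' Set.Ioo a c

lemma isOpen_circleArc (a c : ℝ) : IsOpen (circleArc a c) :=
  QuotientAddGroup.isOpenMap_coe _ isOpen_Ioo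

lemma coe_mem_circleArc {a c : ℝ} (ha : 0 ≤ a) (hc : c ≤ 1) (x : ℝ) :
    (x : UnitAddCircle) ∈ circleArc a c ↔ Int.fract x ∈ Set.Ioo a c := by
  constructor
  · rintro ⟨y, hy, hyx⟩
    obtain ⟨k, hk⟩ := unitAddCircle_coe_eq_coe_iff.1 hyx
    have : Int.fract x = y := by
      rw [Int.fract_eq_iff]
      exact ⟨ha.trans hy.1.le, hy.2.trans_le hc, -k, by push_cast; linarith⟩
    rwa [this]
  · intro h
    exact ⟨Int.fract x, h, unitAddCircle_coe_eq_coe_iff.2 ⟨-⌊x⌋, by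
      push_cast; linarith [Int.self_sub_floor x]⟩⟩

/-- The projection to the circle is injective on `[0, 1]` except for gluing `0` and `1`, so the
preimage of the image in `(0, 1]` differs from `s` at most at the null point `1`. -/
lemma volume_coe_image {s : Set ℝ} (hs : MeasurableSet ((fun x : ℝ => (x : UnitAddCircle)) '' s))
    (h0 : s ⊆ Set.Icc 0 1) :
    volume ((fun x : ℝ => (x : UnitAddCircle)) '' s) = volume s := by
  have hp := UnitAddCircle.measurePreserving_mk 0
  rw [← hp.measure_preimage hs.nullMeasurableSet]
  have : (volume.restrict (Set.Ioc (0 : ℝ) (0 + 1)))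
      ((fun x : ℝ => (x : UnitAddCircle)) ⁻¹' ((fun x : ℝ => (x : UnitAddCircle)) '' s))
      = volume.restrict (Set.Ioc (0 : ℝ) (0 + 1)) s := by
    refine measure_congr ?_
    have h1 : ∀ᵐ x ∂(volume.restrict (Set.Ioc (0 : ℝ) (0 + 1))), x ≠ 1 :=
      ae_restrict_of_ae (Measure.ae_ne volume 1)
    filter_upwards [h1, ae_restrict_mem (measurableSet_Ioc (a := (0 : ℝ)) (b := 0 + 1))]
      with x hx1 hx2
    simp only [Set.mem_Ioc, zero_add] at hx2
    refine propext ⟨?_, fun h => ⟨x, h, rfl⟩⟩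
    rintro ⟨y, hy, hyx⟩
    obtain ⟨k, hk'⟩ := unitAddCircle_coe_eq_coe_iff.1 hyx
    have hy' := h0 hy
    have hxl : x < 1 := lt_of_le_of_ne hx2.2 hx1
    have a1 : (-1 : ℝ) < k := by rw [← hk']; linarith [hy'.1]
    have a2 : (k : ℝ) < 1 := by rw [← hk']; linarith [hy'.2]
    have b1 : -1 < k := by exact_mod_cast a1
    have b2 : k < 1 := by exact_mod_cast a2
    have b3 : k = 0 := by omega
    rw [b3] at hk'
    have : y = x := by push_cast at hk'; linarith
    rwa [← this]
  erw [this]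
  rw [zero_add, Measure.restrict_congr_set Ioc_ae_eq_Icc, Measure.restrict_eq_self _ h0]

lemma volume_circleArc {a c : ℝ} (ha : 0 ≤ a) (hc : c ≤ 1) :
    volume (circleArc a c) = ENNReal.ofReal (c - a) := by
  rw [circleArc, volume_coe_image (isOpen_circleArc a c).measurableSet
    (Set.Ioo_subset_Icc_self.trans (Set.Icc_subset_Icc ha hc)), Real.volume_Ioo]

lemma volume_closure_circleArc {a c : ℝ} (ha : 0 ≤ a) (hc : c ≤ 1) :
    volume (closure (circleArc a c)) = ENNReal.ofReal (c - a) := by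
  refine le_antisymm ?_ ((volume_circleArc ha hc).symm.le.trans (measure_mono subset_closure))
  have hK : IsClosed ((fun x : ℝ => (x : UnitAddCircle)) '' Set.Icc a c) :=
    (isCompact_Icc.image (AddCircle.continuous_mk' 1)).isClosed
  have := volume_coe_image hK.measurableSet (Set.Icc_subset_Icc ha hc)
  rw [Real.volume_Icc] at this
  rw [← this]
  exact measure_mono (closure_minimal (Set.image_mono Set.Ioo_subset_Icc_self) hK)

/-- The uniform probability measure on the first `N + 1` terms of a sequence. -/
noncomputable def empiricalMeasure {X : Type*} [MeasurableSpace X] (x : ℕ → X) (N : ℕ) :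
    Measure X :=
  ((N + 1 : ℕ) : ENNReal)⁻¹ • ∑ n ∈ Finset.Icc 1 (N + 1), Measure.dirac (x n)

instance {X : Type*} [MeasurableSpace X] (x : ℕ → X) (N : ℕ) :
    IsProbabilityMeasure (empiricalMeasure x N) := by
  constructor
  simp only [empiricalMeasure, Measure.smul_apply, Measure.finsetSum_apply, measure_univ,
    Finset.sum_const, Nat.card_Icc, Nat.add_sub_cancel, smul_eq_mul, nsmul_eq_mul, mul_one]
  exact ENNReal.inv_mul_cancel (by simp) (ENNReal.natCast_ne_top _)

lemma integral_empiricalMeasure {X : Type*} [TopologicalSpace X] [MeasurableSpace X]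
    [OpensMeasurableSpace X] (x : ℕ → X) (N : ℕ) (f : BoundedContinuousFunction X ℂ) :
    ∫ t, f t ∂(empiricalMeasure x N)
      = (∑ n ∈ Finset.Icc 1 (N + 1), f (x n)) / ((N + 1 : ℕ) : ℂ) := by
  rw [empiricalMeasure, integral_smul_measure, integral_finsetSum_measure]
  · simp only [integral_dirac' _ _ f.continuous.stronglyMeasurable]
    simp [ENNReal.toReal_inv, div_eq_inv_mul]
    left
    norm_cast
  · intro i _
    exact f.integrable _

/-- The functions with the right limit form a subspace, closed under uniform limits because averages
and integral both contract the sup norm. It contains the characters, whose span is dense. -/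
lemma tendsto_average_of_mFourier {d : ℕ} {x : ℕ → UnitAddTorus (Fin d)}
    (h : ∀ m : Fin d → ℤ, m ≠ 0 → Tendsto (fun N : ℕ =>
      (∑ n ∈ Finset.Icc 1 (N + 1), UnitAddTorus.mFourier m (x n)) / ((N + 1 : ℕ) : ℂ))
      atTop (𝓝 0)) (f : C(UnitAddTorus (Fin d), ℂ)) :
    Tendsto (fun N : ℕ => (∑ n ∈ Finset.Icc 1 (N + 1), f (x n)) / ((N + 1 : ℕ) : ℂ)) atTop
      (𝓝 (∫ t, f t ∂(Measure.pi fun _ : Fin d => (volume : Measure UnitAddCircle)))) := by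
  set μ := (Measure.pi fun _ : Fin d => (volume : Measure UnitAddCircle)) with hμ
  have hint : ∀ g : C(UnitAddTorus (Fin d), ℂ), Integrable g μ := fun g =>
    (BoundedContinuousFunction.mkOfCompact g).integrable μ
  let S : Submodule ℂ C(UnitAddTorus (Fin d), ℂ) :=
    { carrier := {f | Tendsto (fun N : ℕ => (∑ n ∈ Finset.Icc 1 (N + 1), f (x n)) /
        ((N + 1 : ℕ) : ℂ)) atTop (𝓝 (∫ t, f t ∂μ))}
      zero_mem' := by simp
      add_mem' := by
        intro f g hf hg
        have := Tendsto.add hf hg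
        simp only [Set.mem_ofPred_eq, ContinuousMap.add_apply, Finset.sum_add_distrib, add_div]
        rwa [integral_add (hint f) (hint g)]
      smul_mem' := by
        intro c f hf
        have := Tendsto.const_mul c hf
        simp only [Set.mem_ofPred_eq, ContinuousMap.smul_apply, smul_eq_mul, ← Finset.mul_sum,
          mul_div_assoc]
        rwa [integral_const_mul] }
  have hS : Submodule.span ℂ (Set.range (UnitAddTorus.mFourier (d := Fin d))) ≤ S := by
    rw [Submodule.span_le]
    rintro _ ⟨m, rfl⟩
    show Tendsto _ _ _
    by_cases hm : m = 0
    · subst hm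
      have : ∫ t, UnitAddTorus.mFourier (0 : Fin d → ℤ) t ∂μ = 1 := by
        simp [UnitAddTorus.mFourier_zero]
      rw [this]
      refine tendsto_const_nhds.congr fun N => ?_
      have : ((N + 1 : ℕ) : ℂ) ≠ 0 := by exact_mod_cast N.succ_ne_zero
      simp only [UnitAddTorus.mFourier_zero, ContinuousMap.one_apply, Finset.sum_const,
        Nat.card_Icc, Nat.add_sub_cancel, nsmul_eq_mul, mul_one, div_self this]
    · rw [integral_mFourier hm]
      exact h m hm
  have hf : f ∈ (Submodule.span ℂ (Set.range (UnitAddTorus.mFourier (d := Fin d)))).topologicalClosure := by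
    rw [UnitAddTorus.span_mFourier_closure_eq_top]; trivial
  have hf' : f ∈ closure (S : Set C(UnitAddTorus (Fin d), ℂ)) :=
    closure_mono hS hf
  rw [Metric.tendsto_atTop]
  intro ε hε
  obtain ⟨g, hg, hfg⟩ := Metric.mem_closure_iff.1 hf' (ε / 3) (by positivity)
  obtain ⟨K, hK⟩ := Metric.tendsto_atTop.1 (show Tendsto _ _ _ from hg) (ε / 3) (by positivity)
  have hpt : ∀ t, ‖f t - g t‖ ≤ ε / 3 := fun t => by
    rw [← dist_eq_norm]; exact (ContinuousMap.dist_apply_le_dist t).trans hfg.le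
  refine ⟨K, fun N hN => ?_⟩
  have e1 : dist ((∑ n ∈ Finset.Icc 1 (N + 1), f (x n)) / ((N + 1 : ℕ) : ℂ))
      ((∑ n ∈ Finset.Icc 1 (N + 1), g (x n)) / ((N + 1 : ℕ) : ℂ)) ≤ ε / 3 := by
    rw [dist_eq_norm, ← sub_div, ← Finset.sum_sub_distrib, norm_div, Complex.norm_natCast,
      div_le_iff₀ (by positivity)]
    refine (norm_sum_le_of_le _ fun n _ => hpt (x n)).trans (le_of_eq ?_)
    simp [mul_comm]
  have e2 : dist (∫ t, g t ∂μ) (∫ t, f t ∂μ) ≤ ε / 3 := by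
    rw [dist_comm, dist_eq_norm, ← integral_sub (hint f) (hint g)]
    refine (norm_integral_le_of_norm_le_const (ae_of_all _ hpt)).trans (le_of_eq ?_)
    simp
  have e3 := hK N hN
  have := dist_triangle4 ((∑ n ∈ Finset.Icc 1 (N + 1), f (x n)) / ((N + 1 : ℕ) : ℂ))
    ((∑ n ∈ Finset.Icc 1 (N + 1), g (x n)) / ((N + 1 : ℕ) : ℂ)) (∫ t, g t ∂μ) (∫ t, f t ∂μ)
  linarith

lemma mFourier_coe {d : ℕ} (m : Fin d → ℤ) (y : Fin d → ℝ) :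
    UnitAddTorus.mFourier m (fun i => (y i : UnitAddCircle))
      = Complex.exp (2 * Real.pi * Complex.I * ((∑ i, (m i : ℝ) * y i : ℝ) : ℂ)) := by
  simp only [UnitAddTorus.mFourier, ContinuousMap.coe_mk, fourier_coe_apply]
  rw [← Complex.exp_sum]
  push_cast
  rw [Finset.mul_sum]
  congr 1
  refine Finset.sum_congr rfl fun i _ => ?_
  simp; ring

lemma WeylSumsVanishUniformly.tendsto_average {d : ℕ} {y : ℕ → Fin d → ℝ}
    (h : WeylSumsVanishUniformly y) {m : Fin d → ℤ} (hm : m ≠ 0) :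
    Tendsto (fun N : ℕ => (∑ n ∈ Finset.Icc 1 (N + 1),
      UnitAddTorus.mFourier m (fun i => (y n i : UnitAddCircle))) / ((N + 1 : ℕ) : ℂ))
      atTop (𝓝 0) := by
  have h1 : Tendsto (fun N : ℕ => ((0 : ℕ), N + 1)) atTop
      (comap (fun w : ℕ × ℕ => (w.2 : ℤ) - (w.1 : ℤ)) atTop) := by
    rw [tendsto_comap_iff]
    refine (tendsto_natCast_atTop_atTop.comp (tendsto_add_atTop_nat 1)).congr fun N => ?_
    simp
  refine ((h m hm).comp h1).congr fun N => ?_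
  simp only [Function.comp, mFourier_coe]
  rw [show Finset.Ioc 0 (N + 1) = Finset.Icc 1 (N + 1) from rfl]
  simp

/-- Weyl's criterion. -/
theorem WeylSumsVanishUniformly.isUniformlyDistributedModOne {d : ℕ} {y : ℕ → Fin d → ℝ}
    (h : WeylSumsVanishUniformly y) : IsUniformlyDistributedModOne y := by
  intro a c hac
  let x : ℕ → UnitAddTorus (Fin d) := fun n i => (y n i : UnitAddCircle)
  let μ : ProbabilityMeasure (UnitAddTorus (Fin d)) :=
    ⟨Measure.pi fun _ : Fin d => (volume : Measure UnitAddCircle), inferInstance⟩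
  let ν : ℕ → ProbabilityMeasure (UnitAddTorus (Fin d)) :=
    fun N => ⟨empiricalMeasure x N, inferInstance⟩
  have hν : Tendsto ν atTop (𝓝 μ) := by
    rw [ProbabilityMeasure.tendsto_iff_forall_integral_rclike_tendsto ℂ]
    intro f
    simp only [ν, ProbabilityMeasure.coe_mk, integral_empiricalMeasure]
    exact tendsto_average_of_mFourier (x := x) (fun m hm => h.tendsto_average hm) f.toContinuousMap
  let U : Set (UnitAddTorus (Fin d)) := Set.univ.pi fun i => circleArc (a i) (c i)
  have hUo : IsOpen U := isOpen_set_pi Set.finite_univ fun i _ => isOpen_circleArc _ _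
  have hvol : (μ : Measure _) U = ∏ i, ENNReal.ofReal (c i - a i) := by
    refine (Measure.pi_pi _ _).trans (Finset.prod_congr rfl fun i _ => ?_)
    exact volume_circleArc (hac i).1 (hac i).2.2
  have hvolc : (μ : Measure _) (closure U) = ∏ i, ENNReal.ofReal (c i - a i) := by
    rw [closure_pi_set]
    refine (Measure.pi_pi _ _).trans (Finset.prod_congr rfl fun i _ => ?_)
    exact volume_closure_circleArc (hac i).1 (hac i).2.2
  -- The box and its closure have equal finite measure, so its boundary is null and weak convergence
  -- gives convergence on the box.
  have hfr : μ (frontier U) = 0 := by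
    rw [ProbabilityMeasure.null_iff_toMeasure_null, hUo.frontier_eq, measure_sdiff subset_closure hUo.measurableSet.nullMeasurableSet
      (measure_ne_top _ _), hvol, hvolc, tsub_self]
  have hlim := ProbabilityMeasure.tendsto_measure_of_null_frontier_of_tendsto hν hfr
  rw [← tendsto_add_atTop_iff_nat 1]
  have hlim' : Tendsto (fun N => ((ν N U : NNReal) : ℝ)) atTop (𝓝 ((μ U : NNReal) : ℝ)) :=
    (NNReal.continuous_coe.tendsto _).comp hlim
  have hμ : ((μ U : NNReal) : ℝ) = ∏ i, (c i - a i) := by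
    show ENNReal.toReal ((μ : Measure _) U) = _
    rw [hvol, ENNReal.toReal_prod]
    refine Finset.prod_congr rfl fun i _ => ENNReal.toReal_ofReal ?_
    linarith [(hac i).2.1]
  rw [hμ] at hlim'
  refine hlim'.congr fun N => ?_
  show ENNReal.toReal (empiricalMeasure x N U) = _
  classical
  have hset : {n : ℕ | n ∈ Finset.Icc 1 (N + 1) ∧ ∀ i, Int.fract (y n i) ∈ Set.Ioo (a i) (c i)}
      = ↑((Finset.Icc 1 (N + 1)).filter fun n => x n ∈ U) := by
    ext n
    simp only [Set.mem_ofPred_eq, Finset.coe_filter, U, Set.mem_pi, Set.mem_univ, true_implies, x,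
      coe_mem_circleArc (hac _).1 (hac _).2.2]
  rw [hset, Set.ncard_coe_finset, empiricalMeasure, Measure.smul_apply, Measure.finsetSum_apply]
  simp only [Measure.dirac_apply' _ hUo.measurableSet, Set.indicator_apply, Pi.one_apply,
    Finset.sum_boole, smul_eq_mul, ENNReal.toReal_mul, ENNReal.toReal_inv, ENNReal.toReal_natCast]
  rw [div_eq_inv_mul]

end Weyl

/-! ### Digit substitution enumerates the Cantor set. -/

section Enumeration

/-- The digit substitution `D.card`-ary expansion ↦ `b`-ary expansion with digits in `D`. -/
noncomputable def cantorValue (b : ℕ) (D : Finset ℕ) (n : ℕ) : ℕ :=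
  Nat.ofDigits b ((Nat.digits D.card n).map (Nat.nth (· ∈ D)))

/-- The sum of the digits substituted in `cantorValue`. -/
noncomputable def cantorDigitSum (D : Finset ℕ) (n : ℕ) : ℕ :=
  ((Nat.digits D.card n).map (Nat.nth (· ∈ D))).sum

variable {b : ℕ} {D : Finset ℕ}

lemma finite_setOf_mem_finset : (Set.ofPred (· ∈ D)).Finite := D.finite_toSet

lemma finite_mem_card : (finite_setOf_mem_finset (D := D)).toFinset.card = D.card := by
  congr 1; ext; simp

lemma nth_digit_mem {i : ℕ} (hi : i < D.card) : Nat.nth (· ∈ D) i ∈ D :=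
  Nat.nth_mem_of_lt_card finite_setOf_mem_finset (by rwa [finite_mem_card])

lemma nth_digit_lt {i j : ℕ} (hij : i < j) (hj : j < D.card) :
    Nat.nth (· ∈ D) i < Nat.nth (· ∈ D) j :=
  Nat.nth_lt_nth' hij fun h => by
    convert hj using 1; congr 1; ext; simp

lemma exists_nth_digit {d : ℕ} (hd : d ∈ D) : ∃ i < D.card, Nat.nth (· ∈ D) i = d := by
  obtain ⟨i, hi, h⟩ := Nat.exists_lt_card_finite_nth_eq finite_setOf_mem_finset hd
  exact ⟨i, by rwa [finite_mem_card] at hi, h⟩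

lemma nth_digit_zero (hzero : 0 ∈ D) : Nat.nth (· ∈ D) 0 = 0 :=
  Nat.nth_zero_of_zero hzero

lemma sum_nth_digit {M : Type*} [AddCommMonoid M] (g : ℕ → M) :
    ∑ i ∈ Finset.range D.card, g (Nat.nth (· ∈ D) i) = ∑ d ∈ D, g d := by
  refine Finset.sum_bij (fun i _ => Nat.nth (· ∈ D) i) ?_ ?_ ?_ ?_
  · intro i hi; exact nth_digit_mem (Finset.mem_range.1 hi)
  · intro i hi j hj h
    rw [Finset.mem_range] at hi hj
    rcases lt_trichotomy i j with h1 | h1 | h1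
    · exact absurd h (nth_digit_lt h1 hj).ne
    · exact h1
    · exact absurd h (nth_digit_lt h1 hi).ne'
  · intro d hd
    obtain ⟨i, hi, h⟩ := exists_nth_digit hd
    exact ⟨i, Finset.mem_range.2 hi, h⟩
  · intros; rfl

lemma cantorValue_zero : cantorValue b D 0 = 0 := by simp [cantorValue]

lemma cantorDigitSum_zero : cantorDigitSum D 0 = 0 := by simp [cantorDigitSum]

lemma cantorValue_add_mul (hcard : 2 ≤ D.card) (hzero : 0 ∈ D) {i : ℕ} (hi : i < D.card) (n : ℕ) :
    cantorValue b D (i + D.card * n) = Nat.nth (· ∈ D) i + b * cantorValue b D n := by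
  by_cases h : i ≠ 0 ∨ n ≠ 0
  · rw [cantorValue, Nat.digits_add _ hcard _ _ hi h, List.map_cons, Nat.ofDigits_cons]
    simp [cantorValue]
  -- The digit list of `0` is empty, so this case needs `0` to be the first element of `D`.
  · push Not at h
    obtain ⟨rfl, rfl⟩ := h
    simp [cantorValue_zero, nth_digit_zero hzero]

lemma cantorDigitSum_add_mul (hcard : 2 ≤ D.card) (hzero : 0 ∈ D) {i : ℕ} (hi : i < D.card)
    (n : ℕ) :
    cantorDigitSum D (i + D.card * n) = Nat.nth (· ∈ D) i + cantorDigitSum D n := by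
  by_cases h : i ≠ 0 ∨ n ≠ 0
  · rw [cantorDigitSum, Nat.digits_add _ hcard _ _ hi h, List.map_cons, List.sum_cons]
    simp [cantorDigitSum]
  · push Not at h
    obtain ⟨rfl, rfl⟩ := h
    simp [cantorDigitSum_zero, nth_digit_zero hzero]

lemma cantorValue_add_pow_mul (hcard : 2 ≤ D.card) (hzero : 0 ∈ D) (l : ℕ) {m : ℕ}
    (hm : m < D.card ^ l) (n : ℕ) :
    cantorValue b D (m + D.card ^ l * n) = cantorValue b D m + b ^ l * cantorValue b D n := by
  induction l generalizing m with
  | zero => obtain rfl : m = 0 := by simpa using hm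
            simp [cantorValue_zero]
  | succ l ih =>
    have hlt : m % D.card < D.card := Nat.mod_lt _ (by omega)
    have hdiv : m / D.card < D.card ^ l := by
      rw [Nat.div_lt_iff_lt_mul (by omega), ← pow_succ]; exact hm
    have e1 : m + D.card ^ (l + 1) * n
        = m % D.card + D.card * (m / D.card + D.card ^ l * n) := by
      conv_lhs => rw [← Nat.mod_add_div m D.card]
      ring
    have e2 : cantorValue b D m
        = Nat.nth (· ∈ D) (m % D.card) + b * cantorValue b D (m / D.card) := by
      rw [← cantorValue_add_mul hcard hzero hlt, Nat.mod_add_div]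
    rw [e1, cantorValue_add_mul hcard hzero hlt, ih hdiv, e2]
    ring

lemma cantorDigitSum_add_pow_mul (hcard : 2 ≤ D.card) (hzero : 0 ∈ D) (l : ℕ) {m : ℕ}
    (hm : m < D.card ^ l) (n : ℕ) :
    cantorDigitSum D (m + D.card ^ l * n) = cantorDigitSum D m + cantorDigitSum D n := by
  induction l generalizing m with
  | zero => obtain rfl : m = 0 := by simpa using hm
            simp [cantorDigitSum_zero]
  | succ l ih =>
    have hlt : m % D.card < D.card := Nat.mod_lt _ (by omega)
    have hdiv : m / D.card < D.card ^ l := by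
      rw [Nat.div_lt_iff_lt_mul (by omega), ← pow_succ]; exact hm
    have e1 : m + D.card ^ (l + 1) * n
        = m % D.card + D.card * (m / D.card + D.card ^ l * n) := by
      conv_lhs => rw [← Nat.mod_add_div m D.card]
      ring
    have e2 : cantorDigitSum D m
        = Nat.nth (· ∈ D) (m % D.card) + cantorDigitSum D (m / D.card) := by
      rw [← cantorDigitSum_add_mul hcard hzero hlt, Nat.mod_add_div]
    rw [e1, cantorDigitSum_add_mul hcard hzero hlt, ih hdiv, e2]
    ring

lemma two_le_base (hD : D ⊆ Finset.range b) (hcard : 2 ≤ D.card) : 2 ≤ b := by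
  simpa using hcard.trans (Finset.card_le_card hD)

lemma sumOfDigits_cantorValue (hD : D ⊆ Finset.range b) (hcard : 2 ≤ D.card) (hzero : 0 ∈ D)
    (n : ℕ) : sumOfDigits b (cantorValue b D n) = cantorDigitSum D n := by
  induction n using Nat.strong_induction_on with
  | _ n ih =>
    rcases Nat.eq_zero_or_pos n with rfl | hn
    · simp [cantorValue_zero, cantorDigitSum_zero, sumOfDigits]
    have hlt : n % D.card < D.card := Nat.mod_lt _ (by omega)
    have := ih _ (Nat.div_lt_self hn hcard)
    conv_lhs => rw [← Nat.mod_add_div n D.card]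
    conv_rhs => rw [← Nat.mod_add_div n D.card]
    rw [cantorValue_add_mul hcard hzero hlt, cantorDigitSum_add_mul hcard hzero hlt, ← this]
    have hb := two_le_base hD hcard
    have hd := Finset.mem_range.1 (hD (nth_digit_mem hlt))
    by_cases h : Nat.nth (· ∈ D) (n % D.card) ≠ 0 ∨ cantorValue b D (n / D.card) ≠ 0
    · rw [sumOfDigits, Nat.digits_add _ (by omega) _ _ hd h]
      simp [sumOfDigits]
    · push Not at h
      simp [h.1, h.2, sumOfDigits]

/-- Digits in `D` lie below `b`, so the quotients by `D.card` decide the order, and the last digit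
decides only when they agree. -/
lemma cantorValue_strictMono (hD : D ⊆ Finset.range b) (hcard : 2 ≤ D.card) (hzero : 0 ∈ D) :
    StrictMono (cantorValue b D) := by
  have key : ∀ n m, m < n → cantorValue b D m < cantorValue b D n := by
    intro n
    induction n using Nat.strong_induction_on with
    | _ n ih =>
      intro m hmn
      have hn : 0 < n := by omega
      have h1 : n % D.card < D.card := Nat.mod_lt _ (by omega)
      have h2 : m % D.card < D.card := Nat.mod_lt _ (by omega)
      rw [← Nat.mod_add_div n D.card, ← Nat.mod_add_div m D.card,
        cantorValue_add_mul hcard hzero h1, cantorValue_add_mul hcard hzero h2]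
      have hd2 := Finset.mem_range.1 (hD (nth_digit_mem h2))
      rcases (Nat.div_le_div_right (c := D.card) hmn.le).lt_or_eq with h | h
      · have := ih _ (Nat.div_lt_self hn hcard) _ h
        have : b * (cantorValue b D (m / D.card) + 1) ≤ b * cantorValue b D (n / D.card) :=
          Nat.mul_le_mul_left _ this
        rw [mul_add] at this
        omega
      · rw [h]
        have : m % D.card < n % D.card := by
          have e1 := Nat.mod_add_div n D.card
          have e2 := Nat.mod_add_div m D.card
          rw [h] at e2
          omega
        have := nth_digit_lt this h1
        omega
  exact fun m n h => key n m h

lemma range_cantorValue (hcard : 2 ≤ D.card) (hzero : 0 ∈ D) :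
    Set.range (cantorValue b D) = integerCantorSet b D := by
  ext v
  constructor
  · rintro ⟨n, rfl⟩
    induction n using Nat.strong_induction_on with
    | _ n ih =>
      rcases Nat.eq_zero_or_pos n with rfl | hn
      · exact ⟨0, fun _ => 0, fun _ _ => hzero, by simp [cantorValue_zero]⟩
      have hlt : n % D.card < D.card := Nat.mod_lt _ (by omega)
      obtain ⟨k, d, hd, he⟩ := ih _ (Nat.div_lt_self hn hcard)
      refine ⟨k + 1, fun j => Nat.casesOn j (Nat.nth (· ∈ D) (n % D.card)) d, ?_, ?_⟩
      · rintro (_ | j) hj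
        · exact nth_digit_mem hlt
        · exact hd j (by omega)
      · conv_lhs => rw [← Nat.mod_add_div n D.card]
        rw [cantorValue_add_mul hcard hzero hlt, he,
          Finset.sum_range_succ' _ (k + 1), Finset.mul_sum, add_comm]
        simp only [pow_zero, mul_one]
        congr 1
        refine Finset.sum_congr rfl fun j _ => ?_
        ring
  · rintro ⟨k, d, hd, rfl⟩
    induction k generalizing d with
    | zero =>
      obtain ⟨i, hi, h⟩ := exists_nth_digit (hd 0 le_rfl)
      refine ⟨i, ?_⟩
      have := cantorValue_add_mul (b := b) hcard hzero hi 0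
      simp only [mul_zero, add_zero, cantorValue_zero] at this
      simp [this, h]
    | succ k ih =>
      obtain ⟨i, hi, h⟩ := exists_nth_digit (hd 0 (by omega))
      obtain ⟨n, hn⟩ := ih (fun j => d (j + 1)) fun j hj => hd _ (by omega)
      refine ⟨i + D.card * n, ?_⟩
      rw [cantorValue_add_mul hcard hzero hi, hn, h, Finset.sum_range_succ' _ (k + 1),
        Finset.mul_sum, add_comm]
      simp only [pow_zero, mul_one, add_left_inj]
      refine Finset.sum_congr rfl fun j _ => ?_
      ring

lemma cantorSeq_eq_cantorValue (hD : D ⊆ Finset.range b) (hcard : 2 ≤ D.card) (hzero : 0 ∈ D)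
    (n : ℕ) : cantorSeq b D n = cantorValue b D (n - 1) := by
  have hp : ∀ k, cantorValue b D k ∈ integerCantorSet b D := fun k => by
    rw [← range_cantorValue hcard hzero]; exact ⟨k, rfl⟩
  have hinf : (Set.ofPred fun m => m ∈ integerCantorSet b D).Infinite := by
    show (integerCantorSet b D).Infinite
    rw [← range_cantorValue hcard hzero]
    exact Set.infinite_range_of_injective (cantorValue_strictMono hD hcard hzero).injective
  have := Nat.nth_comp_of_strictMono (p := fun m => m ∈ integerCantorSet b D) (n := n - 1)
    (cantorValue_strictMono hD hcard hzero)
    (fun k hk => by rw [range_cantorValue hcard hzero]; exact hk) (fun hf => absurd hf hinf)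
  rw [cantorSeq, ← this]
  congr 1
  simp only [hp]
  exact Nat.nth_true _

end Enumeration

/-! ### The additive character. -/

section Exponential

/-- The additive character `e(x) = exp(2πix)`. -/
noncomputable def expTwoPi (x : ℝ) : ℂ := Complex.exp (2 * Real.pi * Complex.I * (x : ℂ))

@[simp] lemma expTwoPi_zero : expTwoPi 0 = 1 := by simp [expTwoPi]

lemma expTwoPi_add (x y : ℝ) : expTwoPi (x + y) = expTwoPi x * expTwoPi y := by
  rw [expTwoPi, expTwoPi, expTwoPi, ← Complex.exp_add]; push_cast; ring_nf

@[simp] lemma norm_expTwoPi (x : ℝ) : ‖expTwoPi x‖ = 1 := by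
  have : (2 * Real.pi * Complex.I * (x : ℂ)) = ((2 * Real.pi * x : ℝ) : ℂ) * Complex.I := by
    push_cast; ring
  rw [expTwoPi, this, Complex.norm_exp_ofReal_mul_I]

lemma expTwoPi_neg (x : ℝ) : expTwoPi (-x) = starRingEnd ℂ (expTwoPi x) := by
  rw [expTwoPi, expTwoPi, ← Complex.exp_conj]
  congr 1
  simp only [map_mul, Complex.conj_I, Complex.conj_ofReal, map_ofNat]
  push_cast
  ring

lemma expTwoPi_sub (x y : ℝ) : expTwoPi (x - y) = expTwoPi x * starRingEnd ℂ (expTwoPi y) := by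
  rw [sub_eq_add_neg, expTwoPi_add, expTwoPi_neg]

lemma expTwoPi_nat_mul (n : ℕ) (x : ℝ) : expTwoPi (n * x) = expTwoPi x ^ n := by
  rw [expTwoPi, expTwoPi, ← Complex.exp_nat_mul]; push_cast; ring_nf

lemma expTwoPi_eq_one_iff {x : ℝ} : expTwoPi x = 1 ↔ ∃ k : ℤ, x = k := by
  rw [expTwoPi, Complex.exp_eq_one_iff]
  have h : (2 * Real.pi * Complex.I : ℂ) ≠ 0 := by simp [Real.pi_ne_zero]
  refine exists_congr fun k => ?_
  rw [mul_comm (k : ℂ), mul_right_inj' h]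
  norm_cast

lemma expTwoPi_intCast (k : ℤ) : expTwoPi k = 1 := expTwoPi_eq_one_iff.2 ⟨k, rfl⟩

lemma expTwoPi_add_int (x : ℝ) (k : ℤ) : expTwoPi (x + k) = expTwoPi x := by
  rw [expTwoPi_add, expTwoPi_intCast, mul_one]

end Exponential

/-! ### Averages over independent digits. -/

section Averages

variable (b : ℕ) (D : Finset ℕ)

/-- The pair of the `n`-th element of the Cantor set, shifted by `j` digits, and its digit sum. -/
noncomputable def cantorPoint (j n : ℕ) : ℤ × ℤ :=
  (((b ^ j * cantorValue b D n : ℕ) : ℤ), (cantorDigitSum D n : ℤ))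

/-- The average of `G` over all sums of `n` digits in the positions `j, …, j + n - 1`. -/
noncomputable def cantorAvg (j n : ℕ) (G : ℤ × ℤ → ℂ) : ℂ :=
  (∑ m ∈ Finset.range (D.card ^ n), G (cantorPoint b D j m)) / ((D.card ^ n : ℕ) : ℂ)

variable {b D}

lemma cantorPoint_add_pow_mul (hcard : 2 ≤ D.card) (hzero : 0 ∈ D) (j l : ℕ) {m : ℕ}
    (hm : m < D.card ^ l) (n : ℕ) :
    cantorPoint b D j (m + D.card ^ l * n) = cantorPoint b D j m + cantorPoint b D (j + l) n := by
  rw [cantorPoint, cantorValue_add_pow_mul hcard hzero l hm,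
    cantorDigitSum_add_pow_mul hcard hzero l hm]
  ext
  · simp only [cantorPoint, Prod.mk_add_mk]; push_cast; ring
  · simp [cantorPoint]

lemma cantorPoint_of_lt (hcard : 2 ≤ D.card) (hzero : 0 ∈ D) (j : ℕ) {i : ℕ} (hi : i < D.card) :
    cantorPoint b D j i = Nat.nth (· ∈ D) i • ((b : ℤ) ^ j, (1 : ℤ)) := by
  have h1 := cantorValue_add_mul (b := b) hcard hzero hi 0
  have h2 := cantorDigitSum_add_mul hcard hzero hi 0
  simp only [mul_zero, add_zero, cantorValue_zero, cantorDigitSum_zero] at h1 h2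
  rw [cantorPoint, h1, h2]
  ext
  · simp [mul_comm]
  · simp

lemma sum_range_mul_eq {M : Type*} [AddCommMonoid M] (A B : ℕ) (g : ℕ → M) :
    ∑ m ∈ Finset.range (A * B), g m
      = ∑ m₂ ∈ Finset.range B, ∑ m₁ ∈ Finset.range A, g (m₁ + A * m₂) := by
  induction B with
  | zero => simp
  | succ B ih =>
    rw [Finset.sum_range_succ, ← ih, mul_add, mul_one, Finset.sum_range_add]
    simp [add_comm]

/-- Low and high digits are independent: no carries occur, so a block average is an iterated average
over the two digit ranges. -/
lemma cantorAvg_add (hcard : 2 ≤ D.card) (hzero : 0 ∈ D) (j n₁ n₂ : ℕ) (G : ℤ × ℤ → ℂ) :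
    cantorAvg b D j (n₁ + n₂) G
      = cantorAvg b D j n₁ fun x => cantorAvg b D (j + n₁) n₂ fun y => G (x + y) := by
  simp only [cantorAvg]
  rw [pow_add, sum_range_mul_eq, ← Finset.sum_div, Finset.sum_comm, div_div, mul_comm (_ ^ n₁)]
  push_cast
  congr 1
  refine Finset.sum_congr rfl fun m hm => Finset.sum_congr rfl fun m' _ => ?_
  rw [cantorPoint_add_pow_mul hcard hzero _ _ (Finset.mem_range.1 hm)]

lemma cantorAvg_one (hcard : 2 ≤ D.card) (hzero : 0 ∈ D) (j : ℕ) (G : ℤ × ℤ → ℂ) :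
    cantorAvg b D j 1 G = (∑ d ∈ D, G (d • ((b : ℤ) ^ j, (1 : ℤ)))) / (D.card : ℂ) := by
  rw [cantorAvg, pow_one, ← sum_nth_digit fun d => G (d • ((b : ℤ) ^ j, (1 : ℤ)))]
  congr 1
  refine Finset.sum_congr rfl fun i hi => ?_
  rw [cantorPoint_of_lt hcard hzero j (Finset.mem_range.1 hi)]

lemma norm_cantorAvg_le (hcard : 2 ≤ D.card) (j n : ℕ) {G : ℤ × ℤ → ℂ} {δ : ℝ}
    (hG : ∀ x, ‖G x‖ ≤ δ) : ‖cantorAvg b D j n G‖ ≤ δ := by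
  have : 0 < D.card := by omega
  rw [cantorAvg, norm_div, Complex.norm_natCast, div_le_iff₀ (by positivity)]
  refine (norm_sum_le_of_le _ fun n _ => hG _).trans (le_of_eq ?_)
  simp [mul_comm]

lemma cantorAvg_const (hcard : 2 ≤ D.card) (j n : ℕ) (c : ℂ) :
    cantorAvg b D j n (fun _ => c) = c := by
  have : ((D.card ^ n : ℕ) : ℂ) ≠ 0 := by
    have : D.card ^ n ≠ 0 := pow_ne_zero _ (by omega)
    exact_mod_cast this
  rw [cantorAvg, Finset.sum_const, Finset.card_range, nsmul_eq_mul, mul_div_assoc, mul_comm,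
    div_mul_cancel₀ _ this]

lemma cantorAvg_expTwoPi_succ (hcard : 2 ≤ D.card) (hzero : 0 ∈ D) (j n : ℕ) (φ : ℤ × ℤ →+ ℝ) :
    cantorAvg b D j (n + 1) (fun x => expTwoPi (φ x))
      = cantorAvg b D j n (fun x => expTwoPi (φ x)) *
        ((∑ d ∈ D, expTwoPi (d * φ ((b : ℤ) ^ (j + n), 1))) / (D.card : ℂ)) := by
  rw [cantorAvg_add hcard hzero]
  simp only [cantorAvg_one hcard hzero, map_add, expTwoPi_add, ← Finset.mul_sum, map_nsmul]
  simp only [nsmul_eq_mul]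
  rw [cantorAvg, cantorAvg, div_mul_eq_mul_div, Finset.sum_mul]
  congr 1
  exact Finset.sum_congr rfl fun _ _ => mul_div_assoc _ _ _

end Averages

/-! ### Linear phases. -/

section Linear

/-- The point `1` repels under `z ↦ z ^ b`: near it the geometric sum multiplying `z - 1` has norm
above `1`. So the distance to `1` is eventually nondecreasing, yet tends to `0`. -/
lemma exists_eq_one_of_tendsto_one_of_pow {b : ℕ} (hb : 2 ≤ b) {z : ℕ → ℂ}
    (hz : Tendsto z atTop (𝓝 1)) (hpow : ∀ n, z (n + 1) = z n ^ b) : ∃ n, z n = 1 := by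
  have h1 : Tendsto (fun n => ‖∑ i ∈ Finset.range b, z n ^ i‖) atTop (𝓝 b) := by
    have : Tendsto (fun n => ‖∑ i ∈ Finset.range b, z n ^ i‖) atTop
        (𝓝 ‖∑ i ∈ Finset.range b, (1 : ℂ) ^ i‖) :=
      (tendsto_finsetSum _ fun i _ => hz.pow i).norm
    simpa using this
  have h2 : ∀ᶠ n in atTop, 1 < ‖∑ i ∈ Finset.range b, z n ^ i‖ :=
    h1.eventually (lt_mem_nhds (by exact_mod_cast (show 1 < b by omega)))
  obtain ⟨K, hK⟩ := eventually_atTop.1 h2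
  have hmono : Monotone fun n => ‖z (K + n) - 1‖ := by
    refine monotone_nat_of_le_succ fun n => ?_
    show _ ≤ ‖z (K + n + 1) - 1‖
    rw [hpow, ← mul_geom_sum, norm_mul]
    exact le_mul_of_one_le_right (norm_nonneg _) (hK _ (by omega)).le
  have hlim : Tendsto (fun n => ‖z (K + n) - 1‖) atTop (𝓝 0) := by
    have : Tendsto (fun n => ‖z n - 1‖) atTop (𝓝 0) := by
      simpa using (hz.sub_const 1).norm
    exact (this.comp (tendsto_add_atTop_nat K)).congr fun n => by
      simp [add_comm]
  refine ⟨K, ?_⟩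
  have := hmono.ge_of_tendsto hlim 0
  simpa [sub_eq_zero] using this

lemma norm_sub_one_sq {z : ℂ} (hz : ‖z‖ = 1) : ‖z - 1‖ ^ 2 = 4 - ‖1 + z‖ ^ 2 := by
  have := parallelogram_law_with_norm ℝ z 1
  rw [hz, norm_one, add_comm z 1] at this
  linarith

variable {b : ℕ} {D : Finset ℕ}

lemma addHom_prod_apply (φ : ℤ × ℤ →+ ℝ) (u v : ℤ) : φ (u, v) = u * φ (1, 0) + v * φ (0, 1) := by
  have : ((u, v) : ℤ × ℤ) = u • (1, 0) + v • (0, 1) := by simp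
  rw [this, map_add, map_zsmul, map_zsmul]
  simp

lemma norm_sum_expTwoPi_le {d₀ : ℕ} (hzero : 0 ∈ D) (hd₀ : d₀ ∈ D) (h0 : d₀ ≠ 0) (θ : ℝ) :
    ‖∑ d ∈ D, expTwoPi (d * θ)‖ ≤ ‖1 + expTwoPi (d₀ * θ)‖ + (D.card - 2) := by
  have hm : d₀ ∈ D.erase 0 := Finset.mem_erase.2 ⟨h0, hd₀⟩
  rw [← Finset.add_sum_erase _ _ hzero, ← Finset.add_sum_erase _ _ hm, ← add_assoc]
  have hc : (((D.erase 0).erase d₀).card : ℝ) = D.card - 2 := by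
    have h1 := Finset.card_erase_add_one hzero
    have h2 := Finset.card_erase_add_one hm
    rw [← h1, ← h2]; push_cast; ring
  simp only [Nat.cast_zero, zero_mul, expTwoPi_zero]
  refine (norm_add_le _ _).trans (add_le_add_right ?_ _)
  rw [← hc]
  refine (norm_sum_le _ _).trans (le_of_eq ?_)
  simp

/-- The norms `P n` decrease, being multiplied by digit factors `c n ≤ 1`. A positive limit would
force `c n → 1`, hence `e(d₀ * θ n) → 1` for a nonzero digit `d₀`, as the digit `0` contributes `1`.
The recursion between `θ n` and `θ (n + 1)` then makes both coordinates of `φ` rational. -/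
theorem tendsto_norm_cantorAvg_linear (hD : D ⊆ Finset.range b) (hcard : 2 ≤ D.card)
    (hzero : 0 ∈ D) (φ : ℤ × ℤ →+ ℝ) (hφ : ∃ x, Irrational (φ x)) (j : ℕ) :
    Tendsto (fun n => ‖cantorAvg b D j n fun x => expTwoPi (φ x)‖) atTop (𝓝 0) := by
  have hb := two_le_base hD hcard
  have hr : (0 : ℝ) < D.card := by exact_mod_cast (show 0 < D.card by omega)
  obtain ⟨d₀, hd₀, h0⟩ : ∃ d ∈ D, d ≠ 0 := Finset.exists_mem_ne (by omega) 0
  set P : ℕ → ℝ := fun n => ‖cantorAvg b D j n fun x => expTwoPi (φ x)‖ with hP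
  set θ : ℕ → ℝ := fun n => φ ((b : ℤ) ^ (j + n), 1) with hθ
  set c : ℕ → ℝ := fun n => ‖(∑ d ∈ D, expTwoPi (d * θ n)) / (D.card : ℂ)‖ with hc
  have hPc : ∀ n, P (n + 1) = P n * c n := fun n => by
    simp only [hP, hc, cantorAvg_expTwoPi_succ hcard hzero, norm_mul, hθ]
  have hc' : ∀ n, c n = ‖∑ d ∈ D, expTwoPi (d * θ n)‖ / D.card := fun n => by
    simp [hc]
  have hc1 : ∀ n, c n ≤ 1 := fun n => by
    rw [hc', div_le_one hr]
    refine (norm_sum_le _ _).trans (le_of_eq ?_)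
    simp
  have hP0 : ∀ n, 0 ≤ P n := fun n => norm_nonneg _
  have hanti : Antitone P := antitone_nat_of_succ_le fun n => by
    rw [hPc]; exact mul_le_of_le_one_right (hP0 n) (hc1 n)
  have hbdd : BddBelow (Set.range P) := ⟨0, by rintro _ ⟨n, rfl⟩; exact hP0 n⟩
  have hlim := tendsto_atTop_ciInf hanti hbdd
  by_cases hl : (⨅ n, P n) = 0
  · rwa [hl] at hlim
  exfalso
  have hPne : ∀ n, P n ≠ 0 := fun n hn => hl <| le_antisymm
    ((ciInf_le hbdd n).trans hn.le) (le_ciInf hP0)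
  have hc_lim : Tendsto c atTop (𝓝 1) := by
    have := ((hlim.comp (tendsto_add_atTop_nat 1)).div hlim hl)
    rw [div_self hl] at this
    refine this.congr fun n => ?_
    simp only [Function.comp, Pi.div_apply, hPc, mul_div_cancel_left₀ _ (hPne n)]
  set z : ℕ → ℂ := fun n => expTwoPi (d₀ * θ n) with hz
  have hz1 : Tendsto z atTop (𝓝 1) := by
    have h1 : Tendsto (fun n => ‖1 + z n‖) atTop (𝓝 2) := by
      have hl : Tendsto (fun n => c n * D.card - (D.card - 2)) atTop (𝓝 2) := by
        have := (hc_lim.mul_const (D.card : ℝ)).sub_const ((D.card : ℝ) - 2)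
        convert this using 2; ring
      refine tendsto_of_tendsto_of_tendsto_of_le_of_le hl tendsto_const_nhds (fun n => ?_)
        fun n => ?_
      · have := norm_sum_expTwoPi_le hzero hd₀ h0 (θ n)
        simp only [hc', div_mul_cancel₀ _ hr.ne']
        linarith
      · refine (norm_add_le _ _).trans (le_of_eq ?_)
        simp [hz]; norm_num
    have h2 : Tendsto (fun n => ‖z n - 1‖ ^ 2) atTop (𝓝 0) := by
      have := (h1.pow 2).const_sub 4
      norm_num at this
      exact this.congr fun n => (norm_sub_one_sq (norm_expTwoPi _)).symm
    have h3 : Tendsto (fun n => ‖z n - 1‖) atTop (𝓝 0) := by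
      have := h2.sqrt
      simpa [Real.sqrt_sq] using this
    exact tendsto_iff_norm_sub_tendsto_zero.2 h3
  have hθs : ∀ n, (b : ℝ) * θ n = θ (n + 1) + (b - 1) * φ (0, 1) := fun n => by
    simp only [hθ]
    rw [addHom_prod_apply φ _ 1, addHom_prod_apply φ (_ ^ (j + (n + 1))) 1]
    push_cast
    rw [← add_assoc, pow_succ]
    ring
  have hzs : ∀ n, z n ^ b = z (n + 1) * expTwoPi (d₀ * ((b - 1) * φ (0, 1))) := fun n => by
    simp only [hz]
    rw [← expTwoPi_nat_mul, ← expTwoPi_add]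
    congr 1
    linear_combination (d₀ : ℝ) * hθs n
  -- Pass to the limit in `hzs`: both `z n ^ b` and `z (n + 1)` tend to `1`.
  have hconst : expTwoPi (d₀ * ((b - 1) * φ (0, 1))) = 1 := by
    have h1 := hz1.pow b
    simp only [hzs] at h1
    have h2 := (hz1.comp (tendsto_add_atTop_nat 1)).mul_const
      (expTwoPi (d₀ * ((b - 1) * φ (0, 1))))
    have := tendsto_nhds_unique h1 h2
    simpa using this.symm
  obtain ⟨n, hn⟩ := exists_eq_one_of_tendsto_one_of_pow hb hz1 fun n => by
    rw [hzs, hconst, mul_one]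
  obtain ⟨k₁, hk₁⟩ := expTwoPi_eq_one_iff.1 hconst
  obtain ⟨k₂, hk₂⟩ := expTwoPi_eq_one_iff.1 hn
  have hd0' : (d₀ : ℝ) ≠ 0 := by exact_mod_cast h0
  have hb1 : (b : ℝ) - 1 ≠ 0 := by
    have : (2 : ℝ) ≤ b := by exact_mod_cast hb
    linarith
  have hb0 : (b : ℝ) ≠ 0 := by
    have : (2 : ℝ) ≤ b := by exact_mod_cast hb
    linarith
  have hβ : φ (0, 1) = ((k₁ / (d₀ * (b - 1)) : ℚ) : ℝ) := by
    push_cast; field_simp; linarith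
  have hα : φ (1, 0) = (((k₂ / d₀ - k₁ / (d₀ * (b - 1))) / b ^ (j + n) : ℚ) : ℝ) := by
    simp only [hθ] at hk₂
    rw [addHom_prod_apply, hβ] at hk₂
    push_cast at hk₂ ⊢
    rw [eq_div_iff (by positivity), eq_sub_iff_add_eq, eq_div_iff hd0']
    linarith
  obtain ⟨p, hp⟩ : ∃ p : ℚ, φ (1, 0) = p := ⟨_, hα⟩
  obtain ⟨q, hq⟩ : ∃ q : ℚ, φ (0, 1) = q := ⟨_, hβ⟩
  obtain ⟨⟨u, v⟩, hx⟩ := hφ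
  apply hx
  rw [addHom_prod_apply, hp, hq]
  exact ⟨u * p + v * q, by push_cast; rfl⟩

end Linear

/-! ### Differences of random points are rarely rational. -/

section Anticoncentration

/-- The points with rational value form a subgroup of `ℤ × ℤ`, hence finitely generated; the product
of the generators' denominators serves. -/
lemma exists_common_denominator (φ : ℤ × ℤ →+ ℝ) :
    ∃ q : ℕ, 0 < q ∧ ∀ x, ¬ Irrational (φ x) → ∃ k : ℤ, q * φ x = k := by
  let H : Submodule ℤ (ℤ × ℤ) :=
    AddSubgroup.toIntSubmodule (((Rat.castHom ℝ : ℚ →+* ℝ).toAddMonoidHom.range).comap φ)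
  have hH : ∀ x, x ∈ H ↔ ¬ Irrational (φ x) := fun x => by
    rw [Irrational, not_not]; exact Iff.rfl
  obtain ⟨S, hS⟩ : H.FG := IsNoetherian.noetherian H
  have hex : ∀ s : ℤ × ℤ, ∃ q : ℕ, 0 < q ∧ (s ∈ S → ∃ k : ℤ, q * φ s = k) := fun s => by
    by_cases hs : s ∈ S
    · have : s ∈ H := hS ▸ Submodule.subset_span hs
      rw [hH, Irrational, not_not] at this
      obtain ⟨p, hp⟩ := this
      refine ⟨p.den, p.den_pos, fun _ => ⟨p.num, ?_⟩⟩
      rw [← hp, mul_comm]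
      exact_mod_cast p.mul_den_eq_num
    · exact ⟨1, one_pos, fun h => absurd h hs⟩
  choose q hq hqk using hex
  refine ⟨∏ s ∈ S, q s, Finset.prod_pos fun s _ => hq s, fun x hx => ?_⟩
  rw [← hH, ← hS] at hx
  induction hx using Submodule.span_induction with
  | mem s hs =>
    obtain ⟨k, hk⟩ := hqk s hs
    refine ⟨(∏ t ∈ S.erase s, (q t : ℤ)) * k, ?_⟩
    rw [← Finset.mul_prod_erase S q hs]
    push_cast
    rw [← hk]; ring
  | zero => exact ⟨0, by simp⟩
  | add x y _ _ hx hy =>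
    obtain ⟨k, hk⟩ := hx
    obtain ⟨l, hl⟩ := hy
    exact ⟨k + l, by rw [map_add, mul_add, hk, hl]; push_cast; rfl⟩
  | smul a x _ hx =>
    obtain ⟨k, hk⟩ := hx
    exact ⟨a * k, by rw [map_zsmul, zsmul_eq_mul, mul_left_comm, hk]; push_cast; rfl⟩

variable {b : ℕ} {D : Finset ℕ}

lemma norm_cantorAvg (j n : ℕ) (G : ℤ × ℤ → ℂ) : ‖cantorAvg b D j n G‖
    = ‖∑ m ∈ Finset.range (D.card ^ n), G (cantorPoint b D j m)‖ / (D.card : ℝ) ^ n := by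
  rw [cantorAvg, norm_div, Complex.norm_natCast, Nat.cast_pow]

/-- Expanding both squares gives the same fourfold sum, since `(t - t') * (u m - u m')` is symmetric
in the two roles. -/
lemma normSq_sum_expTwoPi_eq (T : Finset ℕ) (s : Finset ℕ) (u : ℕ → ℝ) :
    ∑ m ∈ s, ∑ m' ∈ s, ‖∑ t ∈ T, expTwoPi (t * (u m - u m'))‖ ^ 2
      = ∑ t ∈ T, ∑ t' ∈ T, ‖∑ m ∈ s, expTwoPi (((t : ℝ) - t') * u m)‖ ^ 2 := by
  have h : ∀ z : ℂ, ((‖z‖ ^ 2 : ℝ) : ℂ) = z * starRingEnd ℂ z := fun z => by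
    rw [Complex.mul_conj, Complex.normSq_eq_norm_sq]
  apply Complex.ofReal_injective
  simp only [Complex.ofReal_sum, h, map_sum, Finset.sum_mul_sum]
  have h1 : ∀ m ∈ s, ∑ m' ∈ s, ∑ t ∈ T, ∑ t' ∈ T,
      expTwoPi (t * (u m - u m')) * (starRingEnd ℂ) (expTwoPi (t' * (u m - u m')))
      = ∑ t ∈ T, ∑ t' ∈ T, ∑ m' ∈ s,
      expTwoPi (((t : ℝ) - t') * u m) * (starRingEnd ℂ) (expTwoPi (((t : ℝ) - t') * u m')) := by
    intro m _
    rw [Finset.sum_comm]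
    refine Finset.sum_congr rfl fun t _ => ?_
    rw [Finset.sum_comm]
    refine Finset.sum_congr rfl fun t' _ => Finset.sum_congr rfl fun m' _ => ?_
    rw [← expTwoPi_sub, ← expTwoPi_sub]
    ring_nf
  rw [Finset.sum_congr rfl h1, Finset.sum_comm]
  refine Finset.sum_congr rfl fun t _ => ?_
  rw [Finset.sum_comm]

open Classical in
/-- The differences of two independent random points rarely take rational values under a
homomorphism that is not rational-valued. -/
theorem exists_card_not_irrational_le (hD : D ⊆ Finset.range b) (hcard : 2 ≤ D.card)
    (hzero : 0 ∈ D) (φ : ℤ × ℤ →+ ℝ) (hφ : ∃ x, Irrational (φ x)) (j : ℕ) {ε : ℝ} (hε : 0 < ε) :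
    ∃ n : ℕ, (((Finset.range (D.card ^ n) ×ˢ Finset.range (D.card ^ n)).filter fun w =>
      ¬ Irrational (φ (cantorPoint b D j w.1 - cantorPoint b D j w.2))).card : ℝ)
        ≤ ε * ((D.card : ℝ) ^ n) ^ 2 := by
  obtain ⟨q, hq, hqk⟩ := exists_common_denominator φ
  obtain ⟨N, hN⟩ := exists_nat_gt (1 / ε)
  have hNpos : (0 : ℝ) < N := (by positivity : 0 < 1 / ε).trans hN
  -- Off the diagonal the phase is a nonzero integer multiple of `φ`, so the linear case applies.
  -- Only `N` of the `N ^ 2` terms survive, leaving `1 / N < ε`.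
  have hterm : ∀ t t' : ℕ, Tendsto (fun n => ‖cantorAvg b D j n fun x =>
      expTwoPi (((t : ℝ) - t') * (q * φ x))‖ ^ 2) atTop (𝓝 (if t = t' then 1 else 0)) := by
    intro t t'
    by_cases h : t = t'
    · subst h
      simp [cantorAvg_const hcard]
    · simp only [h, if_false]
      have hk : ((t : ℤ) - t') * q ≠ 0 :=
        mul_ne_zero (sub_ne_zero.2 (by exact_mod_cast h)) (by exact_mod_cast hq.ne')
      have := tendsto_norm_cantorAvg_linear hD hcard hzero ((((t : ℤ) - t') * q) • φ) (by
        obtain ⟨x, hx⟩ := hφ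
        refine ⟨x, ?_⟩
        rw [AddMonoidHom.smul_apply, zsmul_eq_mul]
        exact hx.intCast_mul hk) j
      have h2 := this.pow 2
      rw [zero_pow two_ne_zero] at h2
      refine h2.congr fun n => ?_
      congr 3
      ext x
      rw [AddMonoidHom.smul_apply, zsmul_eq_mul]
      push_cast
      ring_nf
  have hsum : Tendsto (fun n => (∑ t ∈ Finset.range N, ∑ t' ∈ Finset.range N,
      ‖cantorAvg b D j n fun x => expTwoPi (((t : ℝ) - t') * (q * φ x))‖ ^ 2) / (N : ℝ) ^ 2)
      atTop (𝓝 (1 / N)) := by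
    have := (tendsto_finsetSum (Finset.range N) fun t _ =>
      tendsto_finsetSum (Finset.range N) fun t' _ => hterm t t').div_const ((N : ℝ) ^ 2)
    convert this using 2
    have : ∀ t ∈ Finset.range N, ∑ t' ∈ Finset.range N, (if t = t' then (1 : ℝ) else 0) = 1 := by
      intro t ht
      rw [Finset.sum_ite_eq, if_pos ht]
    rw [Finset.sum_congr rfl this, Finset.sum_const, Finset.card_range, nsmul_eq_mul]
    field_simp
  have hlt : 1 / (N : ℝ) < ε := by
    rw [div_lt_iff₀ hNpos]; rw [div_lt_iff₀ hε] at hN; linarith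
  obtain ⟨n, hn⟩ := (hsum.eventually (gt_mem_nhds hlt)).exists
  refine ⟨n, ?_⟩
  have hr : (0 : ℝ) < (D.card : ℝ) ^ n := pow_pos (by exact_mod_cast (show 0 < D.card by omega)) _
  rw [div_lt_iff₀ (by positivity)] at hn
  have hn' : ∑ t ∈ Finset.range N, ∑ t' ∈ Finset.range N, ‖∑ m ∈ Finset.range (D.card ^ n),
      expTwoPi (((t : ℝ) - t') * (q * φ (cantorPoint b D j m)))‖ ^ 2
        ≤ ε * (N : ℝ) ^ 2 * ((D.card : ℝ) ^ n) ^ 2 := by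
    rw [← div_le_iff₀ (by positivity)]
    refine le_trans (le_of_eq ?_) hn.le
    simp only [norm_cantorAvg, div_pow, Finset.sum_div]
  rw [← normSq_sum_expTwoPi_eq, ← Finset.sum_product'] at hn'
  -- A pair with rational difference has `q * φ` integral there, so all `N` exponentials equal `1`
  -- and the pair contributes the full `N ^ 2`.
  have hcount : (((Finset.range (D.card ^ n) ×ˢ Finset.range (D.card ^ n)).filter fun w =>
      ¬ Irrational (φ (cantorPoint b D j w.1 - cantorPoint b D j w.2))).card : ℝ) * (N : ℝ) ^ 2
      ≤ ε * (N : ℝ) ^ 2 * ((D.card : ℝ) ^ n) ^ 2 := by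
    refine le_trans ?_ hn'
    rw [Finset.card_filter]
    push_cast
    rw [Finset.sum_mul]
    refine Finset.sum_le_sum fun w _ => ?_
    by_cases hw : Irrational (φ (cantorPoint b D j w.1 - cantorPoint b D j w.2))
    · simp only [hw, not_true_eq_false, if_false, zero_mul]
      positivity
    · obtain ⟨k, hk⟩ := hqk _ hw
      rw [map_sub, mul_sub] at hk
      have h1 : ∀ t : ℕ, expTwoPi (t * k) = 1 := fun t => by
        rw [expTwoPi_nat_mul, expTwoPi_intCast, one_pow]
      rw [if_pos hw, hk]
      simp [h1]
  have hN2 : (0 : ℝ) < (N : ℝ) ^ 2 := by positivity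
  refine le_of_mul_le_mul_right ?_ hN2
  linarith

end Anticoncentration

/-! ### Polynomial degree via iterated differences. -/

section Differences

variable {V : Type*} [AddCommGroup V]

/-- All `n`-fold differences of `f` vanish. -/
def FwdDiffsVanish : ℕ → (V → ℝ) → Prop
  | 0, f => f = 0
  | n + 1, f => ∀ h, FwdDiffsVanish n (fwdDiff h f)

/-- Some `n`-fold difference of `f` is irrational at the origin. -/
def HasIrrationalFwdDiff : ℕ → (V → ℝ) → Prop
  | 0, f => Irrational (f 0)
  | n + 1, f => ∃ h, HasIrrationalFwdDiff n (fwdDiff h f)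

lemma FwdDiffsVanish.add {n : ℕ} {f g : V → ℝ} (hf : FwdDiffsVanish n f)
    (hg : FwdDiffsVanish n g) : FwdDiffsVanish n (f + g) := by
  induction n generalizing f g with
  | zero => simp only [FwdDiffsVanish] at *; simp [hf, hg]
  | succ n ih => intro h; rw [fwdDiff_add]; exact ih (hf h) (hg h)

lemma FwdDiffsVanish.const_smul {n : ℕ} {f : V → ℝ} (hf : FwdDiffsVanish n f) (c : ℝ) :
    FwdDiffsVanish n (c • f) := by
  induction n generalizing f with
  | zero => simp only [FwdDiffsVanish] at *; simp [hf]
  | succ n ih => intro h; rw [fwdDiff_const_smul]; exact ih (hf h)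

lemma FwdDiffsVanish.zero (n : ℕ) : FwdDiffsVanish n (0 : V → ℝ) := by
  induction n with
  | zero => rfl
  | succ n ih => intro h; convert ih; ext; simp [fwdDiff]

lemma FwdDiffsVanish.mono {n m : ℕ} (hnm : n ≤ m) {f : V → ℝ} (hf : FwdDiffsVanish n f) :
    FwdDiffsVanish m f := by
  induction n generalizing m f with
  | zero => rw [FwdDiffsVanish] at hf; subst hf; exact FwdDiffsVanish.zero m
  | succ n ih =>
    obtain ⟨m, rfl⟩ : ∃ k, m = k + 1 := ⟨m - 1, by omega⟩
    exact fun h => ih (by omega) (hf h)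

lemma FwdDiffsVanish.comp_add {n : ℕ} {f : V → ℝ} (hf : FwdDiffsVanish n f) (a : V) :
    FwdDiffsVanish n (fun x => f (x + a)) := by
  induction n generalizing f with
  | zero => rw [FwdDiffsVanish] at *; subst hf; rfl
  | succ n ih =>
    intro h
    convert ih (hf h) using 1
    ext x
    simp only [fwdDiff]
    rw [add_right_comm]

lemma FwdDiffsVanish.eq_const {f : V → ℝ} (hf : FwdDiffsVanish 1 f) (x : V) : f x = f 0 := by
  have := congrFun (hf x) 0
  simp only [fwdDiff, zero_add, Pi.zero_apply] at this
  linarith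

lemma FwdDiffsVanish.exists_addHom {f : V → ℝ} (hf : FwdDiffsVanish 2 f) :
    ∃ φ : V →+ ℝ, ∀ x, f x = f 0 + φ x := by
  refine ⟨AddMonoidHom.mk' (fun x => f x - f 0) fun x y => ?_, fun x => by simp⟩
  have := FwdDiffsVanish.eq_const (hf y) x
  simp only [fwdDiff, zero_add] at this
  linarith

lemma fwdDiff_comm (h k : V) (f : V → ℝ) : fwdDiff h (fwdDiff k f) = fwdDiff k (fwdDiff h f) := by
  ext x
  simp only [fwdDiff, add_right_comm x h k]
  ring

/-- Fix `n` of the directions of an irrational difference: the resulting `n`-fold difference of `f`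
is affine, and `φ` is its linear part. Since differences commute, `φ x` is an `n`-fold difference of
`fwdDiff x f` at the origin. -/
lemma HasIrrationalFwdDiff.exists_addHom {n : ℕ} {f : V → ℝ} (hf : FwdDiffsVanish (n + 2) f)
    (hi : HasIrrationalFwdDiff (n + 1) f) :
    ∃ φ : V →+ ℝ, (∃ x, Irrational (φ x)) ∧
      ∀ x, Irrational (φ x) → HasIrrationalFwdDiff n (fwdDiff x f) := by
  induction n generalizing f with
  | zero =>
    obtain ⟨φ, hφ⟩ := hf.exists_addHom
    have h : ∀ x, fwdDiff x f 0 = φ x := fun x => by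
      simp only [fwdDiff, zero_add]; rw [hφ x]; ring
    obtain ⟨x, hx⟩ := hi
    refine ⟨φ, ⟨x, by rw [← h]; exact hx⟩, fun y hy => ?_⟩
    rw [← h] at hy
    exact hy
  | succ n ih =>
    obtain ⟨k, hk⟩ := hi
    obtain ⟨φ, hφ, h⟩ := ih (hf k) hk
    exact ⟨φ, hφ, fun x hx => ⟨k, by rw [fwdDiff_comm]; exact h x hx⟩⟩

end Differences

/-! ### Van der Corput induction. -/

section VanDerCorput

variable {b : ℕ} {D : Finset ℕ}

/-- Cauchy–Schwarz in `n`, then open the square in `m`. -/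
lemma norm_sum_expTwoPi_sq_le (s t : Finset ℕ) (F : ℕ → ℕ → ℝ) :
    ‖∑ m ∈ s, ∑ n ∈ t, expTwoPi (F m n)‖ ^ 2
      ≤ t.card * ∑ m ∈ s, ∑ m' ∈ s, ‖∑ n ∈ t, expTwoPi (F m n - F m' n)‖ := by
  have h1 : ‖∑ m ∈ s, ∑ n ∈ t, expTwoPi (F m n)‖ ^ 2
      ≤ t.card * ∑ n ∈ t, ‖∑ m ∈ s, expTwoPi (F m n)‖ ^ 2 := by
    rw [Finset.sum_comm]
    refine (pow_le_pow_left₀ (norm_nonneg _) (norm_sum_le _ _) 2).trans ?_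
    exact sq_sum_le_card_mul_sum_sq
  refine h1.trans (mul_le_mul_of_nonneg_left ?_ (Nat.cast_nonneg _))
  have h : ∀ z : ℂ, ((‖z‖ ^ 2 : ℝ) : ℂ) = z * starRingEnd ℂ z := fun z => by
    rw [Complex.mul_conj, Complex.normSq_eq_norm_sq]
  have h2 : ((∑ n ∈ t, ‖∑ m ∈ s, expTwoPi (F m n)‖ ^ 2 : ℝ) : ℂ)
      = ∑ m ∈ s, ∑ m' ∈ s, ∑ n ∈ t, expTwoPi (F m n - F m' n) := by
    simp only [Complex.ofReal_sum, h, map_sum, Finset.sum_mul_sum, expTwoPi_sub]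
    rw [Finset.sum_comm]
    exact Finset.sum_congr rfl fun _ _ => Finset.sum_comm
  have h3 : ∑ n ∈ t, ‖∑ m ∈ s, expTwoPi (F m n)‖ ^ 2
      = ‖∑ m ∈ s, ∑ m' ∈ s, ∑ n ∈ t, expTwoPi (F m n - F m' n)‖ := by
    rw [← h2, Complex.norm_real, Real.norm_of_nonneg (Finset.sum_nonneg fun _ _ => by positivity)]
  rw [h3]
  exact norm_sum_le_of_le _ fun m _ => norm_sum_le _ _

lemma norm_cantorAvg_expTwoPi_sq_le (hcard : 2 ≤ D.card) (hzero : 0 ∈ D) (j n₁ n₂ : ℕ)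
    (F : ℤ × ℤ → ℝ) :
    ‖cantorAvg b D j (n₁ + n₂) fun x => expTwoPi (F x)‖ ^ 2 * ((D.card : ℝ) ^ n₁) ^ 2
      ≤ ∑ m ∈ Finset.range (D.card ^ n₁), ∑ m' ∈ Finset.range (D.card ^ n₁),
        ‖cantorAvg b D (j + n₁) n₂ fun y => expTwoPi
          (F (cantorPoint b D j m + y) - F (cantorPoint b D j m' + y))‖ := by
  have hr : ∀ n, (0 : ℝ) < (D.card : ℝ) ^ n :=
    fun n => pow_pos (by exact_mod_cast (show 0 < D.card by omega)) _
  rw [cantorAvg_add hcard hzero, norm_cantorAvg]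
  simp only [norm_cantorAvg (j + n₁)]
  simp only [cantorAvg, ← Finset.sum_div, norm_div, div_pow, Complex.norm_natCast, Nat.cast_pow,
    norm_pow]
  have := norm_sum_expTwoPi_sq_le (Finset.range (D.card ^ n₁)) (Finset.range (D.card ^ n₂))
    fun m n => F (cantorPoint b D j m + cantorPoint b D (j + n₁) n)
  rw [Finset.card_range, Nat.cast_pow] at this
  rw [div_mul_cancel₀ _ (pow_pos (hr n₁) 2).ne', div_le_div_iff₀ (pow_pos (hr _) 2) (hr _)]
  nlinarith [hr n₂, this]

/-- Van der Corput induction: the averages of `e(f)` are small uniformly in the terms of lower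
degree. -/
theorem exists_norm_cantorAvg_le (hD : D ⊆ Finset.range b) (hcard : 2 ≤ D.card)
    (hzero : 0 ∈ D) (d : ℕ) (f : ℤ × ℤ → ℝ) (hf : FwdDiffsVanish (d + 2) f)
    (hi : HasIrrationalFwdDiff (d + 1) f) (j : ℕ) {ε : ℝ} (hε : 0 < ε) :
    ∃ n₀, ∀ n ≥ n₀, ∀ g : ℤ × ℤ → ℝ, FwdDiffsVanish (d + 1) g →
      ‖cantorAvg b D j n fun x => expTwoPi (f x + g x)‖ ≤ ε := by
  induction d generalizing f j ε with
  | zero =>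
    -- Here `f` is affine and `g` constant, so everything but `e(φ)` factors out with modulus one.
    obtain ⟨φ, hφ⟩ := hf.exists_addHom
    obtain ⟨h, hh⟩ := hi
    have hirr : Irrational (φ h) := by
      simp only [HasIrrationalFwdDiff, fwdDiff, zero_add, hφ h, add_sub_cancel_left] at hh
      exact hh
    have := tendsto_norm_cantorAvg_linear hD hcard hzero φ ⟨h, hirr⟩ j
    obtain ⟨n₀, hn₀⟩ := eventually_atTop.1 (this.eventually (gt_mem_nhds hε))
    refine ⟨n₀, fun n hn g hg => le_trans (le_of_eq ?_) (hn₀ n hn).le⟩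
    have e : (fun x => expTwoPi (f x + g x))
        = fun x => expTwoPi (f 0 + g 0) * expTwoPi (φ x) := by
      ext x
      rw [← expTwoPi_add, hφ x, hg.eq_const x]
      ring_nf
    rw [e]
    simp only [cantorAvg, ← Finset.mul_sum, mul_div_assoc, norm_mul, norm_expTwoPi, one_mul]
  | succ d ih =>
    classical
    obtain ⟨φ, hφ, hφi⟩ := hi.exists_addHom hf
    obtain ⟨n₁, hn₁⟩ := exists_card_not_irrational_le hD hcard hzero φ hφ j
      (ε := ε ^ 2 / 2) (by positivity)
    have hex : ∀ z : ℤ × ℤ, ∃ n₀, Irrational (φ z) → ∀ n ≥ n₀, ∀ g : ℤ × ℤ → ℝ,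
        FwdDiffsVanish (d + 1) g →
        ‖cantorAvg b D (j + n₁) n fun x => expTwoPi (fwdDiff z f x + g x)‖ ≤ ε ^ 2 / 2 := by
      intro z
      by_cases hz : Irrational (φ z)
      · obtain ⟨n₀, hn₀⟩ := ih (fwdDiff z f) (hf z) (hφi z hz) (j + n₁) (ε := ε ^ 2 / 2)
          (by positivity)
        exact ⟨n₀, fun _ => hn₀⟩
      · exact ⟨0, fun h => absurd h hz⟩
    choose N hN using hex
    set R := Finset.range (D.card ^ n₁) 
    -- With `n₁` fixed only finitely many differences occur, so one threshold serves all of them.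
    refine ⟨n₁ + (R ×ˢ R).sup fun w => N (cantorPoint b D j w.1 - cantorPoint b D j w.2),
      fun n hn g hg => ?_⟩
    obtain ⟨n₂, rfl⟩ : ∃ n₂, n = n₁ + n₂ := ⟨n - n₁, by omega⟩
    have hr : (0 : ℝ) < (D.card : ℝ) ^ n₁ :=
      pow_pos (by exact_mod_cast (show 0 < D.card by omega)) _
    have hvdc := norm_cantorAvg_expTwoPi_sq_le (b := b) hcard hzero j n₁ n₂ fun x => f x + g x
    rw [← Finset.sum_product'] at hvdc
    have hterm : ∀ w ∈ R ×ˢ R, ‖cantorAvg b D (j + n₁) n₂ fun y => expTwoPi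
          ((f (cantorPoint b D j w.1 + y) + g (cantorPoint b D j w.1 + y))
            - (f (cantorPoint b D j w.2 + y) + g (cantorPoint b D j w.2 + y)))‖
        ≤ ε ^ 2 / 2 + if ¬ Irrational (φ (cantorPoint b D j w.1 - cantorPoint b D j w.2))
          then 1 else 0 := by
      intro w hw
      set x := cantorPoint b D j w.1
      set x' := cantorPoint b D j w.2
      by_cases hz : Irrational (φ (x - x'))
      · simp only [hz, not_true_eq_false, if_false, add_zero]
        have hle : N (x - x') ≤ n₂ := by
          have := Finset.le_sup (f := fun w : ℕ × ℕ =>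
            N (cantorPoint b D j w.1 - cantorPoint b D j w.2)) hw
          have h2 : N (x - x') ≤ (R ×ˢ R).sup fun w =>
            N (cantorPoint b D j w.1 - cantorPoint b D j w.2) := this
          omega
        -- Relative to `fwdDiff (x - x') f` at `y`, the shift of the base point to `y + x'` costs
        -- one further difference of `f`; this and the difference of `g` are of lower degree, which
        -- the induction hypothesis absorbs.
        have hg' : FwdDiffsVanish (d + 1) (fwdDiff x' (fwdDiff (x - x') f)
            + fun y => fwdDiff (x - x') g (y + x')) :=
          (hf (x - x') x').add ((hg (x - x')).comp_add x')
        have := hN (x - x') hz n₂ hle _ hg'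
        convert this using 5 with y
        simp only [fwdDiff, Pi.add_apply]
        rw [show y + x' + (x - x') = x + y by abel, add_comm y x']
        ring
      · have h1 : ‖cantorAvg b D (j + n₁) n₂ fun y => expTwoPi
          ((f (x + y) + g (x + y)) - (f (x' + y) + g (x' + y)))‖ ≤ 1 :=
          norm_cantorAvg_le hcard _ _ fun y => (norm_expTwoPi _).le
        simp only [hz, not_false_eq_true, if_true]
        have : 0 < ε ^ 2 / 2 := by positivity
        linarith
    have hsum := hvdc.trans (Finset.sum_le_sum hterm)
    rw [Finset.sum_add_distrib, Finset.sum_const, Finset.sum_boole, nsmul_eq_mul,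
      Finset.card_product, Finset.card_range] at hsum
    push_cast at hsum
    have h2 : ‖cantorAvg b D j (n₁ + n₂) fun x => expTwoPi (f x + g x)‖ ^ 2 ≤ ε ^ 2 := by
      refine le_of_mul_le_mul_right ?_ (pow_pos hr 2)
      refine hsum.trans ?_
      have := hn₁
      linarith
    exact le_of_sq_le_sq h2 hε.le

end VanDerCorput

/-! ### From blocks to arbitrary windows. -/

section Windows

/-- The averages of `u` over the windows `M < n ≤ N` tend to `0` as `N - M → ∞`. -/
def WindowAveragesVanish (u : ℕ → ℂ) : Prop :=
  Tendsto (fun w : ℕ × ℕ => (∑ n ∈ Finset.Ioc w.1 w.2, u n) / ((w.2 : ℂ) - (w.1 : ℂ)))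
    (comap (fun w : ℕ × ℕ => (w.2 : ℤ) - (w.1 : ℤ)) atTop) (𝓝 0)

lemma WindowAveragesVanish.const_mul {u : ℕ → ℂ} (hu : WindowAveragesVanish u) (c : ℂ) :
    WindowAveragesVanish fun n => c * u n := by
  have := Tendsto.const_mul c hu
  rw [mul_zero] at this
  refine this.congr fun w => ?_
  rw [← Finset.mul_sum, mul_div_assoc]

lemma WindowAveragesVanish.sum {ι : Type*} {s : Finset ι} {u : ι → ℕ → ℂ}
    (hu : ∀ i ∈ s, WindowAveragesVanish (u i)) :
    WindowAveragesVanish fun n => ∑ i ∈ s, u i n := by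
  have := tendsto_finsetSum s hu
  rw [Finset.sum_const_zero] at this
  refine this.congr fun w => ?_
  rw [← Finset.sum_div, Finset.sum_comm]

/-- Round both endpoints down to multiples of `B`: the two remainders cost at most `B` each, and the
full blocks between cover length at most `N - M + B`. -/
lemma norm_sum_Ioc_le {u : ℕ → ℂ} (hu : ∀ n, ‖u n‖ ≤ 1) {B : ℕ} (hB : 0 < B) {δ : ℝ}
    (hδ : 0 ≤ δ) (h : ∀ q, ‖∑ i ∈ Finset.range B, u (i + B * q)‖ ≤ δ * B) {M N : ℕ} (hMN : M ≤ N) :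
    ‖∑ n ∈ Finset.Ioc M N, u (n - 1)‖ ≤ δ * ((N : ℝ) - M) + (δ + 2) * B := by
  have hS : ∀ n, ‖∑ i ∈ Finset.range n, u i - ∑ i ∈ Finset.range (B * (n / B)), u i‖ ≤ B := by
    intro n
    rw [Finset.sum_range_sub_sum_range (Nat.mul_div_le n B)]
    refine (norm_sum_le_of_le _ fun i _ => hu i).trans ?_
    rw [Finset.sum_const, nsmul_eq_mul, mul_one]
    have hsub : (Finset.range n).filter (fun k => B * (n / B) ≤ k) ⊆ Finset.Ico (B * (n / B)) n := by
      intro k hk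
      simp only [Finset.mem_filter, Finset.mem_range] at hk
      exact Finset.mem_Ico.2 ⟨hk.2, hk.1⟩
    have hc := Finset.card_le_card hsub
    rw [Nat.card_Ico] at hc
    have := Nat.div_add_mod n B
    have := Nat.mod_lt n hB
    exact_mod_cast (show ((Finset.range n).filter fun k => B * (n / B) ≤ k).card ≤ B by omega)
  have hdiv : M / B ≤ N / B := Nat.div_le_div_right hMN
  have hblock : ‖∑ i ∈ Finset.range (B * (N / B)), u i - ∑ i ∈ Finset.range (B * (M / B)), u i‖
      ≤ δ * (((N : ℝ) - M) + B) := by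
    rw [sum_range_mul_eq, sum_range_mul_eq, Finset.sum_range_sub_sum_range hdiv]
    refine (norm_sum_le_of_le _ fun q _ => h q).trans ?_
    rw [Finset.sum_const, nsmul_eq_mul]
    have hsub : (Finset.range (N / B)).filter (fun k => M / B ≤ k) ⊆ Finset.Ico (M / B) (N / B) := by
      intro k hk
      simp only [Finset.mem_filter, Finset.mem_range] at hk
      exact Finset.mem_Ico.2 ⟨hk.2, hk.1⟩
    have hc := Finset.card_le_card hsub
    rw [Nat.card_Ico] at hc
    have h1 := Nat.div_add_mod N B
    have h2 := Nat.div_add_mod M B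
    have h3 := Nat.mod_lt M hB
    have h4 : ((Finset.range (N / B)).filter fun k => M / B ≤ k).card * B + M ≤ N + B := by
      have : ((Finset.range (N / B)).filter fun k => M / B ≤ k).card * B ≤ (N / B - M / B) * B :=
        Nat.mul_le_mul_right _ hc
      rw [Nat.sub_mul, mul_comm (N / B), mul_comm (M / B)] at this
      have : B * (M / B) ≤ B * (N / B) := Nat.mul_le_mul_left _ hdiv
      omega
    have h5 : (((Finset.range (N / B)).filter fun k => M / B ≤ k).card : ℝ) * B + M ≤ N + B := by
      exact_mod_cast h4
    nlinarith
  have hsum : ∑ n ∈ Finset.Ioc M N, u (n - 1)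
      = ∑ i ∈ Finset.range N, u i - ∑ i ∈ Finset.range M, u i := by
    have h1 := Finset.sum_Ico_add' (fun n => u (n - 1)) M N 1
    simp only [Nat.add_sub_cancel] at h1
    rw [← Finset.sum_Ico_eq_sub _ hMN, h1]
    refine Finset.sum_congr ?_ fun _ _ => rfl
    ext; simp
  rw [hsum]
  have e : ∑ i ∈ Finset.range N, u i - ∑ i ∈ Finset.range M, u i
      = (∑ i ∈ Finset.range N, u i - ∑ i ∈ Finset.range (B * (N / B)), u i)
        + (∑ i ∈ Finset.range (B * (N / B)), u i - ∑ i ∈ Finset.range (B * (M / B)), u i)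
        - (∑ i ∈ Finset.range M, u i - ∑ i ∈ Finset.range (B * (M / B)), u i) := by ring
  rw [e]
  refine (norm_sub_le _ _).trans ?_
  have := norm_add_le (∑ i ∈ Finset.range N, u i - ∑ i ∈ Finset.range (B * (N / B)), u i)
    (∑ i ∈ Finset.range (B * (N / B)), u i - ∑ i ∈ Finset.range (B * (M / B)), u i)
  linarith [hS N, hS M]

lemma windowAveragesVanish_of_blocks {u : ℕ → ℂ} (hu : ∀ n, ‖u n‖ ≤ 1)
    (h : ∀ ε > 0, ∃ B : ℕ, 0 < B ∧ ∀ q, ‖∑ i ∈ Finset.range B, u (i + B * q)‖ ≤ ε * B) :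
    WindowAveragesVanish fun n => u (n - 1) := by
  rw [WindowAveragesVanish, Metric.tendsto_nhds]
  intro ε hε
  obtain ⟨B, hB, hBq⟩ := h (ε / 2) (by positivity)
  obtain ⟨K, hK⟩ := exists_nat_gt ((ε / 2 + 2) * B / (ε / 2))
  rw [div_lt_iff₀ (by positivity)] at hK
  have hev : ∀ᶠ w : ℕ × ℕ in comap (fun w : ℕ × ℕ => (w.2 : ℤ) - (w.1 : ℤ)) atTop,
      ((K : ℤ) + 1) ≤ (w.2 : ℤ) - (w.1 : ℤ) :=
    (eventually_ge_atTop ((K : ℤ) + 1)).comap _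
  filter_upwards [hev] with w hw
  have hle : w.1 ≤ w.2 := by omega
  have hwr : (K : ℝ) + 1 ≤ (w.2 : ℝ) - w.1 := by exact_mod_cast hw
  have hb := norm_sum_Ioc_le hu hB (by positivity) hBq hle
  have hpos : (0 : ℝ) < (w.2 : ℝ) - w.1 := by
    have : (0 : ℝ) ≤ K := Nat.cast_nonneg _
    linarith
  have hn : ‖(w.2 : ℂ) - (w.1 : ℂ)‖ = (w.2 : ℝ) - w.1 := by
    rw [← Real.norm_of_nonneg hpos.le, ← Complex.norm_real]; push_cast; rfl
  rw [dist_zero_right, norm_div, hn, div_lt_iff₀ hpos]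
  nlinarith

variable {b : ℕ} {D : Finset ℕ}

/-- On the `q`-th block the points are `x + y` with `y` fixed, and `f (x + y) = f x + fwdDiff y f
x`. The last term has lower degree, so the van der Corput bound is uniform in `q`. -/
theorem windowAveragesVanish_of_fwdDiffs (hD : D ⊆ Finset.range b) (hcard : 2 ≤ D.card)
    (hzero : 0 ∈ D) {d : ℕ} {f : ℤ × ℤ → ℝ} (hf : FwdDiffsVanish (d + 2) f)
    (hi : HasIrrationalFwdDiff (d + 1) f) :
    WindowAveragesVanish fun n => expTwoPi (f (cantorPoint b D 0 (n - 1))) := by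
  refine windowAveragesVanish_of_blocks (u := fun n => expTwoPi (f (cantorPoint b D 0 n)))
    (fun n => (norm_expTwoPi _).le) fun ε hε => ?_
  obtain ⟨n, hn⟩ := exists_norm_cantorAvg_le hD hcard hzero d f hf hi 0 hε
  have hpos : 0 < D.card ^ n := pow_pos (by omega) _
  refine ⟨D.card ^ n, hpos, fun q => ?_⟩
  have := hn n le_rfl _ (hf (cantorPoint b D n q))
  rw [norm_cantorAvg, div_le_iff₀ (by exact_mod_cast hpos)] at this
  rw [Nat.cast_pow]
  refine le_trans (le_of_eq ?_) this
  congr 1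
  refine Finset.sum_congr rfl fun i hi => ?_
  rw [cantorPoint_add_pow_mul hcard hzero _ _ (Finset.mem_range.1 hi), zero_add]
  congr 1
  simp only [fwdDiff]
  ring

end Windows

/-! ### Polynomial phases: leading part and rational part. -/

section Polynomials

/-- The monomial function on `ℤ²` with exponent `μ`. -/
def monomialFun (μ : Fin 2 →₀ ℕ) (z : ℤ × ℤ) : ℝ := (z.1 : ℝ) ^ μ 0 * (z.2 : ℝ) ^ μ 1

lemma FwdDiffsVanish.addHom_mul {V : Type*} [AddCommGroup V] {n : ℕ} {f : V → ℝ}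
    (hf : FwdDiffsVanish n f) (φ : V →+ ℝ) : FwdDiffsVanish (n + 1) fun x => φ x * f x := by
  induction n generalizing f with
  | zero =>
    rw [FwdDiffsVanish] at hf
    subst hf
    convert FwdDiffsVanish.zero 1 using 1
    ext; simp
  | succ n ih =>
    intro h
    convert (ih (hf h)).add ((hf.comp_add h).const_smul (φ h)) using 1
    ext x
    simp only [fwdDiff, map_add, Pi.add_apply, Pi.smul_apply, smul_eq_mul]
    ring

lemma fwdDiffsVanish_pow_mul_pow (i k : ℕ) :
    FwdDiffsVanish (i + k + 1) fun z : ℤ × ℤ => (z.1 : ℝ) ^ i * (z.2 : ℝ) ^ k := by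
  induction i with
  | zero =>
    induction k with
    | zero =>
      intro h
      simp [FwdDiffsVanish]
      rfl
    | succ k ih =>
      show FwdDiffsVanish (0 + k + 1 + 1) _
      convert ih.addHom_mul ((Int.castAddHom ℝ).comp (AddMonoidHom.snd ℤ ℤ)) using 1
      ext z
      simp [pow_succ']
  | succ i ih =>
    rw [add_right_comm i 1 k]
    convert ih.addHom_mul ((Int.castAddHom ℝ).comp (AddMonoidHom.fst ℤ ℤ)) using 1
    ext z
    simp [pow_succ', mul_assoc]

lemma fwdDiff_iter_fst_mul (i : ℕ) (g h : ℤ → ℤ) :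
    (fwdDiff ((1, 0) : ℤ × ℤ))^[i] (fun z => ((g z.1 * h z.2 : ℤ) : ℝ))
      = fun z => (((fwdDiff 1)^[i] g z.1 * h z.2 : ℤ) : ℝ) := by
  induction i generalizing g with
  | zero => rfl
  | succ i ih =>
    rw [Function.iterate_succ_apply, Function.iterate_succ_apply, ← ih]
    congr 1
    ext z
    simp only [fwdDiff, Prod.fst_add, Prod.snd_add, add_zero]
    push_cast
    ring

lemma fwdDiff_iter_snd_mul (k : ℕ) (g h : ℤ → ℤ) :
    (fwdDiff ((0, 1) : ℤ × ℤ))^[k] (fun z => ((g z.1 * h z.2 : ℤ) : ℝ))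
      = fun z => ((g z.1 * (fwdDiff 1)^[k] h z.2 : ℤ) : ℝ) := by
  induction k generalizing h with
  | zero => rfl
  | succ k ih =>
    rw [Function.iterate_succ_apply, Function.iterate_succ_apply, ← ih]
    congr 1
    ext z
    simp only [fwdDiff, Prod.fst_add, Prod.snd_add, add_zero]
    push_cast
    ring

lemma fwdDiff_iter_monomialFun (i k : ℕ) (μ : Fin 2 →₀ ℕ) :
    (fwdDiff ((1, 0) : ℤ × ℤ))^[i] ((fwdDiff ((0, 1) : ℤ × ℤ))^[k] (monomialFun μ)) 0
      = (((fwdDiff 1)^[i] (fun x : ℤ => x ^ μ 0) 0 * (fwdDiff 1)^[k] (fun x : ℤ => x ^ μ 1) 0 : ℤ)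
        : ℝ) := by
  have : monomialFun μ = fun z => (((fun x : ℤ => x ^ μ 0) z.1 * (fun x : ℤ => x ^ μ 1) z.2 : ℤ) : ℝ)
      := by
    ext z; simp [monomialFun]
  rw [this, fwdDiff_iter_snd_mul k (fun x => x ^ μ 0) (fun x => x ^ μ 1),
    fwdDiff_iter_fst_mul i (fun x => x ^ μ 0) _]
  rfl

lemma HasIrrationalFwdDiff.of_iter {V : Type*} [AddCommGroup V] {n : ℕ} (i : ℕ) (h : V)
    {f : V → ℝ} (hf : HasIrrationalFwdDiff n ((fwdDiff h)^[i] f)) :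
    HasIrrationalFwdDiff (i + n) f := by
  induction i generalizing f with
  | zero => simpa using hf
  | succ i ih =>
    rw [Nat.succ_add]
    exact ⟨h, ih hf⟩

lemma FwdDiffsVanish.sum {V : Type*} [AddCommGroup V] {n : ℕ} {ι : Type*} (s : Finset ι)
    {f : ι → V → ℝ} (hf : ∀ i ∈ s, FwdDiffsVanish n (f i)) :
    FwdDiffsVanish n (∑ i ∈ s, f i) := by
  classical
  induction s using Finset.induction_on with
  | empty => exact FwdDiffsVanish.zero n
  | insert a s ha ih =>
    rw [Finset.sum_insert ha]
    exact (hf a (Finset.mem_insert_self a s)).add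
      (ih fun i hi => hf i (Finset.mem_insert_of_mem hi))

/-- Differencing `ν 0` times in the first and `ν 1` times in the second variable kills every other
monomial of `S`, leaving `c ν` times two factorials. The added linear terms contribute only a
rational number. -/
lemma hasIrrationalFwdDiff_sum_monomialFun {S : Finset (Fin 2 →₀ ℕ)} {c : (Fin 2 →₀ ℕ) → ℝ}
    {ν : Fin 2 →₀ ℕ} (hν : ν ∈ S) (hc : Irrational (c ν))
    (hS : ∀ μ ∈ S, μ 0 + μ 1 ≤ ν 0 + ν 1) (α β : ℚ) :
    HasIrrationalFwdDiff (ν 0 + ν 1) (∑ μ ∈ S, c μ • monomialFun μ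
      + (α : ℝ) • monomialFun (Finsupp.single 0 1) + (β : ℝ) • monomialFun (Finsupp.single 1 1)) := by
  rw [add_comm (ν 0)]
  refine HasIrrationalFwdDiff.of_iter (ν 1) (0, 1) ?_
  rw [← add_zero (ν 0)]
  refine HasIrrationalFwdDiff.of_iter (ν 0) (1, 0) ?_
  simp only [HasIrrationalFwdDiff, fwdDiff_iter_add, fwdDiff_iter_finsetSum,
    fwdDiff_iter_const_smul, Pi.add_apply, Finset.sum_apply, Pi.smul_apply, smul_eq_mul,
    fwdDiff_iter_monomialFun]
  have hmain : ∑ μ ∈ S, c μ * (((fwdDiff 1)^[ν 0] (fun x : ℤ => x ^ μ 0) 0 *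
      (fwdDiff 1)^[ν 1] (fun x : ℤ => x ^ μ 1) 0 : ℤ) : ℝ)
      = ((((ν 0).factorial * (ν 1).factorial : ℕ) : ℤ) : ℝ) * c ν := by
    rw [Finset.sum_eq_single_of_mem ν hν]
    · rw [fwdDiff_iter_eq_factorial, fwdDiff_iter_eq_factorial, mul_comm]
      simp
    · intro μ hμ hne
      have hle := hS μ hμ
      have : μ 0 < ν 0 ∨ μ 1 < ν 1 := by
        by_contra! hcon
        apply hne
        ext i
        fin_cases i
        · show μ 0 = ν 0; omega
        · show μ 1 = ν 1; omega
      rcases this with h | h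
      · rw [fwdDiff_iter_pow_eq_zero_of_lt h]; simp
      · rw [fwdDiff_iter_pow_eq_zero_of_lt h]; simp
  rw [hmain]
  have hfac : (((ν 0).factorial * (ν 1).factorial : ℕ) : ℤ) ≠ 0 := by
    exact_mod_cast (Nat.mul_pos (Nat.factorial_pos _) (Nat.factorial_pos _)).ne'
  -- Only the integrality of these two values matters.
  generalize ((fwdDiff 1)^[ν 0] (fun x : ℤ => x ^ (Finsupp.single 0 1 : Fin 2 →₀ ℕ) 0) 0 *
      (fwdDiff 1)^[ν 1] (fun x : ℤ => x ^ (Finsupp.single 0 1 : Fin 2 →₀ ℕ) 1) 0 : ℤ) = m₁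
  generalize ((fwdDiff 1)^[ν 0] (fun x : ℤ => x ^ (Finsupp.single 1 1 : Fin 2 →₀ ℕ) 0) 0 *
      (fwdDiff 1)^[ν 1] (fun x : ℤ => x ^ (Finsupp.single 1 1 : Fin 2 →₀ ℕ) 1) 0 : ℤ) = m₂
  have := ((hc.intCast_mul hfac).add_ratCast (α * m₁)).add_ratCast (β * m₂)
  push_cast at this ⊢
  exact this

variable {b : ℕ} {D : Finset ℕ}

theorem windowAveragesVanish_sum_monomialFun (hD : D ⊆ Finset.range b) (hcard : 2 ≤ D.card)
    (hzero : 0 ∈ D) {S : Finset (Fin 2 →₀ ℕ)} {c : (Fin 2 →₀ ℕ) → ℝ}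
    {ν : Fin 2 →₀ ℕ} (hν : ν ∈ S) (hc : Irrational (c ν)) (hν0 : ν ≠ 0)
    (hS : ∀ μ ∈ S, μ 0 + μ 1 ≤ ν 0 + ν 1) (α β : ℚ) :
    WindowAveragesVanish fun n => expTwoPi ((∑ μ ∈ S, c μ • monomialFun μ
      + (α : ℝ) • monomialFun (Finsupp.single 0 1) + (β : ℝ) • monomialFun (Finsupp.single 1 1))
        (cantorPoint b D 0 (n - 1))) := by
  obtain ⟨d, hd⟩ : ∃ d, ν 0 + ν 1 = d + 1 := by
    refine ⟨ν 0 + ν 1 - 1, ?_⟩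
    have : ν 0 ≠ 0 ∨ ν 1 ≠ 0 := by
      by_contra! hcon
      apply hν0
      ext i
      fin_cases i
      · exact hcon.1
      · exact hcon.2
    omega
  have hi := hasIrrationalFwdDiff_sum_monomialFun hν hc hS α β
  rw [hd] at hi
  have hmon : ∀ μ : Fin 2 →₀ ℕ, μ 0 + μ 1 ≤ d + 1 → FwdDiffsVanish (d + 2) (monomialFun μ) :=
    fun μ hμ => (fwdDiffsVanish_pow_mul_pow (μ 0) (μ 1)).mono (by omega)
  refine windowAveragesVanish_of_fwdDiffs hD hcard hzero ?_ hi
  refine ((FwdDiffsVanish.sum S fun μ hμ => ?_).add ?_).add ?_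
  · exact (hmon μ (hd ▸ hS μ hμ)).const_smul _
  · exact (hmon _ (by simp)).const_smul _
  · exact (hmon _ (by simp)).const_smul _

lemma exists_period_monomialFun (c : ℚ) (μ : Fin 2 →₀ ℕ) : ∃ q : ℕ, 0 < q ∧
    ∀ z w : ℤ × ℤ, ∃ k : ℤ, c * monomialFun μ (z + (q : ℤ) • w) - c * monomialFun μ z = k := by
  refine ⟨c.den, c.den_pos, fun z w => ?_⟩
  have h : (z.1 + c.den * w.1) ^ μ 0 * (z.2 + c.den * w.2) ^ μ 1
      ≡ z.1 ^ μ 0 * z.2 ^ μ 1 [ZMOD c.den] := by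
    refine Int.ModEq.mul (Int.ModEq.pow _ ?_) (Int.ModEq.pow _ ?_) <;>
    · simp [Int.ModEq]
  obtain ⟨k, hk⟩ := h.symm.dvd
  have hk' : monomialFun μ (z + (c.den : ℤ) • w) - monomialFun μ z = c.den * k := by
    simp only [monomialFun, Prod.fst_add, Prod.snd_add, Prod.smul_fst, Prod.smul_snd, smul_eq_mul]
    exact_mod_cast hk
  refine ⟨c.num * k, ?_⟩
  rw [← mul_sub, hk', ← mul_assoc]
  have : (c : ℝ) * c.den = c.num := by exact_mod_cast c.mul_den_eq_num
  rw [this]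
  push_cast
  rfl

lemma exists_period_sum_monomialFun (S : Finset (Fin 2 →₀ ℕ)) (c : (Fin 2 →₀ ℕ) → ℝ)
    (hc : ∀ μ ∈ S, ¬ Irrational (c μ)) : ∃ q : ℕ, 0 < q ∧
    ∀ z w : ℤ × ℤ, ∃ k : ℤ, (∑ μ ∈ S, c μ * monomialFun μ (z + (q : ℤ) • w))
      - ∑ μ ∈ S, c μ * monomialFun μ z = k := by
  classical
  induction S using Finset.induction_on with
  | empty => exact ⟨1, one_pos, fun _ _ => ⟨0, by simp⟩⟩
  | insert a S ha ih =>
    obtain ⟨q₁, hq₁, h₁⟩ := ih fun μ hμ => hc μ (Finset.mem_insert_of_mem hμ)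
    have hca := hc a (Finset.mem_insert_self a S)
    rw [Irrational, not_not] at hca
    obtain ⟨r, hr⟩ := hca
    obtain ⟨q₂, hq₂, h₂⟩ := exists_period_monomialFun r a
    refine ⟨q₁ * q₂, Nat.mul_pos hq₁ hq₂, fun z w => ?_⟩
    obtain ⟨k₁, hk₁⟩ := h₁ z ((q₂ : ℤ) • w)
    obtain ⟨k₂, hk₂⟩ := h₂ z ((q₁ : ℤ) • w)
    refine ⟨k₁ + k₂, ?_⟩
    rw [smul_smul] at hk₁ hk₂
    rw [mul_comm (q₂ : ℤ)] at hk₂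
    rw [Finset.sum_insert ha, Finset.sum_insert ha, ← hr]
    push_cast at hk₁ hk₂ ⊢
    linarith

lemma sum_expTwoPi_div (q : ℕ) (hq : 0 < q) (x : ℤ) :
    ∑ t ∈ Finset.range q, expTwoPi (t * (x / q : ℝ)) = if (q : ℤ) ∣ x then (q : ℂ) else 0 := by
  have hq' : (q : ℝ) ≠ 0 := by exact_mod_cast hq.ne'
  simp only [expTwoPi_nat_mul]
  split_ifs with h
  · obtain ⟨k, rfl⟩ := h
    have : (((q : ℤ) * k : ℤ) : ℝ) / q = k := by push_cast; field_simp
    rw [this, expTwoPi_intCast]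
    simp
  · have hne : expTwoPi (x / q) ≠ 1 := by
      rw [Ne, expTwoPi_eq_one_iff]
      rintro ⟨k, hk⟩
      apply h
      refine ⟨k, ?_⟩
      rw [div_eq_iff hq'] at hk
      have : (x : ℝ) = ((q * k : ℤ) : ℝ) := by push_cast; linarith
      exact_mod_cast this
    rw [geom_sum_eq hne, ← expTwoPi_nat_mul, mul_div_cancel₀ _ hq', expTwoPi_intCast, sub_self,
      zero_div]

/-- Finite Fourier expansion on `(ℤ / q)²`: the sums over `t` and `s` detect the residues `a`, `c`
of the coordinates of `z`. -/
lemma expTwoPi_eq_sum_of_periodic {q : ℕ} (hq : 0 < q) {R : ℤ × ℤ → ℝ}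
    (hR : ∀ z w : ℤ × ℤ, ∃ k : ℤ, R (z + (q : ℤ) • w) - R z = k) (z : ℤ × ℤ) :
    expTwoPi (R z) = ∑ a ∈ Finset.range q, ∑ c ∈ Finset.range q, ∑ t ∈ Finset.range q,
      ∑ s ∈ Finset.range q, (expTwoPi (R (a, c) - t * (a / q : ℝ) - s * (c / q : ℝ)) / (q : ℂ) ^ 2)
        * expTwoPi (t / q * z.1 + s / q * z.2) := by
  have hq' : (q : ℂ) ≠ 0 := by exact_mod_cast hq.ne'
  have h1 : ∀ a c : ℕ, ∑ t ∈ Finset.range q,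
      ∑ s ∈ Finset.range q, (expTwoPi (R (a, c) - t * (a / q : ℝ) - s * (c / q : ℝ)) / (q : ℂ) ^ 2)
        * expTwoPi (t / q * z.1 + s / q * z.2)
      = expTwoPi (R (a, c)) / (q : ℂ) ^ 2 * ((if (q : ℤ) ∣ z.1 - a then (q : ℂ) else 0)
        * (if (q : ℤ) ∣ z.2 - c then (q : ℂ) else 0)) := by
    intro a c
    rw [← sum_expTwoPi_div q hq, ← sum_expTwoPi_div q hq, Finset.sum_mul_sum, Finset.mul_sum]
    refine Finset.sum_congr rfl fun t _ => ?_
    rw [Finset.mul_sum]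
    refine Finset.sum_congr rfl fun s _ => ?_
    rw [div_mul_eq_mul_div (expTwoPi _), div_mul_eq_mul_div (expTwoPi _), ← expTwoPi_add, ← expTwoPi_add, ← expTwoPi_add]
    congr 2
    push_cast
    ring
  simp only [h1]
  have hdvd : ∀ (x : ℤ) (a : ℕ), a ∈ Finset.range q → ((q : ℤ) ∣ x - a ↔ a = (x % q).toNat) := by
    intro x a ha
    rw [Finset.mem_range] at ha
    have h0 := Int.emod_nonneg x (show (q : ℤ) ≠ 0 by omega)
    have hlt := Int.emod_lt_of_pos x (show (0 : ℤ) < q by omega)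
    rw [← Int.modEq_iff_dvd, Int.ModEq, Int.emod_eq_of_lt (by omega) (by exact_mod_cast ha)]
    omega
  have hmem : ∀ x : ℤ, (x % q).toNat ∈ Finset.range q := by
    intro x
    have h0 := Int.emod_nonneg x (show (q : ℤ) ≠ 0 by omega)
    have hlt := Int.emod_lt_of_pos x (show (0 : ℤ) < q by omega)
    rw [Finset.mem_range]; omega
  have hcast : ∀ x : ℤ, (((x % q).toNat : ℕ) : ℤ) = x % q := fun x =>
    Int.toNat_of_nonneg (Int.emod_nonneg x (show (q : ℤ) ≠ 0 by omega))
  rw [Finset.sum_eq_single_of_mem _ (hmem z.1), Finset.sum_eq_single_of_mem _ (hmem z.2)]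
  · rw [if_pos ((hdvd _ _ (hmem _)).2 rfl), if_pos ((hdvd _ _ (hmem _)).2 rfl), ← sq,
      div_mul_cancel₀ _ (pow_ne_zero 2 hq')]
    obtain ⟨k, hk⟩ := hR (((z.1 % q).toNat : ℤ), ((z.2 % q).toNat : ℤ)) (z.1 / q, z.2 / q)
    rw [hcast, hcast] at hk ⊢
    have : ((z.1 % q, z.2 % q) + (q : ℤ) • (z.1 / q, z.2 / q) : ℤ × ℤ) = z := by
      ext <;> simp [Int.emod_add_mul_ediv]
    rw [this] at hk
    rw [sub_eq_iff_eq_add'.1 hk, expTwoPi_add_int]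
  · intro c hc hne
    rw [if_neg (mt (hdvd _ _ hc).1 hne)]
    simp
  · intro a ha hne
    refine Finset.sum_eq_zero fun c _ => ?_
    rw [if_neg (mt (hdvd _ _ ha).1 hne)]
    simp

lemma evalAtInt_eq_sum (p : MvPolynomial (Fin 2) ℝ) (z : ℤ × ℤ) :
    evalAtInt p ![z.1, z.2] = ∑ μ ∈ p.support, p.coeff μ * monomialFun μ z := by
  rw [evalAtInt, MvPolynomial.eval_eq']
  simp [monomialFun, Fin.prod_univ_two]

theorem IsIrrationalPoly.windowAveragesVanish (hD : D ⊆ Finset.range b) (hcard : 2 ≤ D.card)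
    (hzero : 0 ∈ D) {p : MvPolynomial (Fin 2) ℝ} (hp : IsIrrationalPoly p) :
    WindowAveragesVanish fun n => expTwoPi
      (evalAtInt p ![(cantorPoint b D 0 (n - 1)).1, (cantorPoint b D 0 (n - 1)).2]) := by
  classical
  obtain ⟨μ₀, hμ₀, hirr₀⟩ := hp
  have hsupp : ∀ μ, Irrational (p.coeff μ) → μ ∈ p.support := fun μ hμ =>
    MvPolynomial.mem_support_iff.2 hμ.ne_zero
  obtain ⟨ν, hν, hmax⟩ := Finset.exists_max_image
    (p.support.filter fun μ => μ ≠ 0 ∧ Irrational (p.coeff μ)) (fun μ => μ 0 + μ 1)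
    ⟨μ₀, Finset.mem_filter.2 ⟨hsupp _ hirr₀, hμ₀, hirr₀⟩⟩
  rw [Finset.mem_filter] at hν
  obtain ⟨hνs, hν0, hνi⟩ := hν
  set S := p.support.filter fun μ => μ 0 + μ 1 ≤ ν 0 + ν 1 with hS
  set T := p.support.filter fun μ => ¬ (μ 0 + μ 1 ≤ ν 0 + ν 1) with hT
  -- Maximality of `ν` among nonconstant irrational monomials; the constant one has degree `0`, so
  -- it is not in `T`.
  have hTrat : ∀ μ ∈ T, ¬ Irrational (p.coeff μ) := by
    intro μ hμ hi
    rw [hT, Finset.mem_filter] at hμ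
    refine hμ.2 (hmax μ (Finset.mem_filter.2 ⟨hμ.1, ?_, hi⟩))
    rintro rfl
    exact hμ.2 (by simp)
  obtain ⟨q, hq, hper⟩ := exists_period_sum_monomialFun T p.coeff hTrat
  have hexp : ∀ z : ℤ × ℤ, expTwoPi (evalAtInt p ![z.1, z.2])
      = ∑ a ∈ Finset.range q, ∑ c ∈ Finset.range q, ∑ t ∈ Finset.range q, ∑ s ∈ Finset.range q,
        (expTwoPi ((∑ μ ∈ T, p.coeff μ * monomialFun μ ((a : ℤ), (c : ℤ)))
          - t * (a / q : ℝ) - s * (c / q : ℝ)) / (q : ℂ) ^ 2)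
        * expTwoPi ((∑ μ ∈ S, p.coeff μ • monomialFun μ
          + (((t / q : ℚ)) : ℝ) • monomialFun (Finsupp.single 0 1)
          + (((s / q : ℚ)) : ℝ) • monomialFun (Finsupp.single 1 1)) z) := by
    intro z
    rw [evalAtInt_eq_sum, ← Finset.sum_filter_add_sum_filter_not p.support
      (fun μ => μ 0 + μ 1 ≤ ν 0 + ν 1), expTwoPi_add,
      expTwoPi_eq_sum_of_periodic (R := fun z => ∑ μ ∈ T, p.coeff μ * monomialFun μ z) hq hper z]
    simp only [Finset.mul_sum]
    refine Finset.sum_congr rfl fun a _ => Finset.sum_congr rfl fun c _ =>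
      Finset.sum_congr rfl fun t _ => Finset.sum_congr rfl fun s _ => ?_
    rw [mul_left_comm, ← expTwoPi_add]
    congr 2
    simp [monomialFun, add_assoc, hS]
  simp only [hexp]
  refine WindowAveragesVanish.sum fun a _ => WindowAveragesVanish.sum fun c _ =>
    WindowAveragesVanish.sum fun t _ => WindowAveragesVanish.sum fun s _ =>
    WindowAveragesVanish.const_mul ?_ _
  exact windowAveragesVanish_sum_monomialFun hD hcard hzero (S := S)
    (Finset.mem_filter.2 ⟨hνs, le_rfl⟩) hνi hν0 (fun μ hμ => (Finset.mem_filter.1 hμ).2) _ _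

end Polynomials

/-! ### Conclusion for the Cantor sequence. -/

lemma IsIrrationalPoly.zsmul {p : MvPolynomial (Fin 2) ℝ} (hp : IsIrrationalPoly p) {m : ℤ}
    (hm : m ≠ 0) : IsIrrationalPoly (m • p) := by
  obtain ⟨μ, hμ, h⟩ := hp
  refine ⟨μ, hμ, ?_⟩
  rw [MvPolynomial.coeff_smul, zsmul_eq_mul]
  exact h.intCast_mul hm

lemma evalAtInt_sum_zsmul {d : ℕ} (p : Fin d → MvPolynomial (Fin 2) ℝ) (m : Fin d → ℤ)
    (x : Fin 2 → ℤ) : ∑ i, (m i : ℝ) * evalAtInt (p i) x = evalAtInt (∑ i, m i • p i) x := by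
  simp only [evalAtInt, map_sum, map_zsmul]
  simp only [zsmul_eq_mul]

theorem weylSumsVanishUniformly_cantorSeq {b : ℕ} {D : Finset ℕ} (hD : D ⊆ Finset.range b)
    (hcard : 2 ≤ D.card) (hzero : 0 ∈ D) {d : ℕ} (p : Fin d → MvPolynomial (Fin 2) ℝ)
    (hp : ∀ m : Fin d → ℤ, m ≠ 0 → IsIrrationalPoly (∑ i, m i • p i)) :
    WeylSumsVanishUniformly fun n i => evalAtInt (p i)
      ![(cantorSeq b D n : ℤ), (sumOfDigits b (cantorSeq b D n) : ℤ)] := by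
  intro m hm
  have h := (hp m hm).windowAveragesVanish hD hcard hzero
  simp only [evalAtInt_sum_zsmul]
  refine Tendsto.congr (fun w => ?_) h
  congr 1
  refine Finset.sum_congr rfl fun n _ => ?_
  rw [cantorSeq_eq_cantorValue hD hcard hzero, sumOfDigits_cantorValue hD hcard hzero]
  simp [cantorPoint, expTwoPi]

theorem mainTheorem4 (b : ℕ) (D : Finset ℕ) (hD : D ⊆ Finset.range b) (hcard : 2 ≤ D.card)
    (hzero : 0 ∈ D) :
    IsPUDU (fun n => ![(cantorSeq b D n : ℤ), (sumOfDigits b (cantorSeq b D n) : ℤ)]) := by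
  refine ⟨fun p hp => ?_, fun p hp => ?_⟩
  · have h := weylSumsVanishUniformly_cantorSeq hD hcard hzero (fun _ : Fin 1 => p) fun m hm => by
      rw [Fin.sum_univ_one]
      exact hp.zsmul fun h0 => hm (funext fun i => by rw [Subsingleton.elim i 0, h0]; rfl)
    exact ⟨h.isUniformlyDistributedModOne, h⟩
  · have h := weylSumsVanishUniformly_cantorSeq hD hcard hzero p hp
    exact ⟨h.isUniformlyDistributedModOne, h⟩
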